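/- **Theorem (adequacy of the set-theoretic semantics of $\lambda_{\mathrm{mon}}$).** Let $\Theta;\Gamma\vdash_E P,Q : X$ be two well-typed *proper* terms of $\lambda_{\mathrm{mon}}$ (both value terms of a value type $X$, or both computation terms of an $E$-computation type $X$), given with proper typing derivations. If $[\![P]\!]=[\![Q]\!]$, i.e. the denotations of the two derivations agree for every assignment $\theta$ of sets to the type variables in $\Theta$, then $P$ and $Q$ are contextually equivalent. *The calculus.* Terms (up to $\alpha$-equivalence, without type annotations): $V ::= x \mid () \mid (V,V') \mid \mathsf{inj}_\ell V \mid \{M\}$; $M ::= \mathsf{case}\,V\,\mathsf{of}\,(x_1,x_2)\to M \mid \mathsf{case}\,V\,\mathsf{of}\,\{\mathsf{inj}_{\ell_i}x_i\to M_i\}_i \mid V! \mid \mathsf{return}\,V \mid x\leftarrow M;N \mid \lambda x.M \mid M\,V \mid \langle M,N\rangle \mid \mathsf{prj}_i M \mid [N]^T \mid \mu(N)$, where $[N]^T$ is reification, $\mu(N)$ is reflection, and $T=\mathsf{where}\{\mathsf{return}\,x=N_u;\ y\mathbin{>\!\!>\!\!=}f=N_b\}$ with $N_u,N_b$ closed apart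 from $x$ and $y,f$. Types: effects $E::=\emptyset\mid E\prec(\alpha.C)T$; value types $A::=\alpha\mid 1\mid A\times B\mid\{\mathsf{inj}_{\ell_i}A_i\}_i\mid U_E C$; computation types $C::=FA\mid A\to C\mid C\,\&\,D$. *Reduction.* $\leadsto$ is the closure of the following rules under the evaluation contexts built from the frames $x\leftarrow[\,];N$, $[\,]\,V$, $\mathsf{prj}_i[\,]$ (the basic frames) and $[\,[\,]\,]^T$: the usual $\beta$-rules of call-by-push-value, together with $[\mathsf{return}\,V]^T\to N_u[V/x]$ and $[H[\mu(N)]]^T\to N_b[\{N\}/y,\{\lambda x.[H[\mathsf{return}\,x]]^T\}/f]$ for $H$ a stack of basic frames. *Kinding and typing* are those of call-by-push-value with thunk types $U_EC$ and one effect $E$ per computation judgement (no coercions: $x\leftarrow M;N$ requires the same $E$ throughout, $\mathsf{return}\,V$ may have any well-kinded $E$), and: $\Theta\vdash E\prec(\alpha.C)T$ is well-kinded if $E$ is, $C$ is an $E$-computation type over $\Theta,\alpha$, and $\Theta,\alpha;\,x:\alpha\vdash_E N_u:C$ and $\Theta,\alpha_1,\alpha_2;\,y:U_EC[\alpha_1/\alpha],\,f:U_E(\alpha_1\to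 C[\alpha_2/\alpha])\vdash_E N_b:C[\alpha_2/\alpha]$; for such an effect, $\Gamma\vdash_{E\prec(\alpha.C)T}N:FA$ gives $\Gamma\vdash_E[N]^T:C[A/\alpha]$, and $\Gamma\vdash_E N:C[A/\alpha]$ gives $\Gamma\vdash_{E\prec(\alpha.C)T}\mu(N):FA$. *Semantics* (partial, defined on derivations, given $\theta$). An effect denotes a monad on sets: $\emptyset$ the identity monad; $E\prec(\alpha.C)T$ the type constructor $X\mapsto|[\![C]\!]_{\theta[\alpha\mapsto X]}|$ with return and bind the denotations of $N_u$ and $N_b$, which is defined only if these data satisfy the monad laws. Value types denote sets and $U_EC$ denotes the carrier $|[\![C]\!]|$; an $E$-computation type denotes an algebra for the monad of $E$: $FA$ the free algebra, $A\to C$ and $C\,\&\,D$ the pointwise and componentwise ones. Terms denote functions $[\![\Gamma]\!]\to[\![A]\!]$, respectively $[\![\Gamma]\!]\to|[\![C]\!]|$, in the standard way; sequencing is Kleisli extension into the algebra, and reification and reflection denote the identity. A derivation has a denotation only if all its sub-derivations (including those of kinding conditions) have one. A derivation is *proper* if its denotation is defined for all $\theta$; a term is proper (at a given judgement) if it has a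 proper derivation. *Contextual equivalence.* Plugged proper contexts of $P,Q$ form the smallest set of tuples $\langle\Theta',\Gamma',V_1,V_2,A\rangle$ and $\langle\Theta',\Gamma',E',N_1,N_2,C\rangle$, with both terms proper, that contains $P,Q$ at their effect and type over all $\Theta'\supseteq\Theta$ and all $\Gamma'$ extending $\Gamma$ (where $P,Q$ are proper), and is compatible with the typing rules. $P$ and $Q$ are contextually equivalent if for every ground type $G$ ($G::=1\mid G\times G'\mid\{\mathsf{inj}_{\ell_i}G_i\}_i$), every plugged proper context $\langle\emptyset,\emptyset,\emptyset,M_P,M_Q,FG\rangle$ and every closed value $V:G$: $M_P\leadsto^*\mathsf{return}\,V\iff M_Q\leadsto^*\mathsf{return}\,V$. -/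

import Mathlib

universe u

namespace LMon

/-- Extend a finite sequence by a new entry with index `0` (the most recent de Bruijn index). -/
def push {α : Sort*} {n : ℕ} (a : α) (f : Fin n → α) : Fin (n + 1) → α :=
  fun i => Fin.cases (motive := fun _ => α) a f i

/-- Lift a renaming under one binder. -/
def liftR {n n' : ℕ} (r : Fin n → Fin n') : Fin (n + 1) → Fin (n' + 1) :=
  push 0 (fun i => (r i).succ)

/-! ### Raw terms

Raw terms are untyped and carry no type annotations. They are represented up to renaming of
bound variables by de Bruijn indices: `Val m` and `Comp m` are the value and computation terms
whose free term variables are among `m` variables. Constructor labels are natural numbers. -/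

mutual
/-- Value terms. -/
inductive Val : ℕ → Type
  | var {m : ℕ} (i : Fin m) : Val m
  | unit {m : ℕ} : Val m
  | pair {m : ℕ} (V W : Val m) : Val m
  | inj {m : ℕ} (l : ℕ) (V : Val m) : Val m
  | thunk {m : ℕ} (M : Comp m) : Val m
/-- Computation terms. `split V M` is `case V of (x₁, x₂) → M`, where `x₁` has index `1` and `x₂`
index `0` in `M`; `vcase V k l M` is `case V of {inj_{l i} x → M i}_{i < k}`; `seq M N` is
`x ← M; N`; `cpair` is the computation pair; `prj true` and `prj false` are the first and second
projection; `reify T N` is `[N]^T`; `reflect N` is `μ(N)`. -/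
inductive Comp : ℕ → Type
  | split {m : ℕ} (V : Val m) (M : Comp (m + 2)) : Comp m
  | vcase {m : ℕ} (V : Val m) (k : ℕ) (l : Fin k → ℕ) (M : Fin k → Comp (m + 1)) : Comp m
  | force {m : ℕ} (V : Val m) : Comp m
  | ret {m : ℕ} (V : Val m) : Comp m
  | seq {m : ℕ} (M : Comp m) (N : Comp (m + 1)) : Comp m
  | lam {m : ℕ} (M : Comp (m + 1)) : Comp m
  | app {m : ℕ} (M : Comp m) (V : Val m) : Comp m
  | cpair {m : ℕ} (M N : Comp m) : Comp m
  | prj {m : ℕ} (b : Bool) (M : Comp m) : Comp m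
  | reify {m : ℕ} (T : Mon) (N : Comp m) : Comp m
  | reflect {m : ℕ} (N : Comp m) : Comp m
/-- User-defined monads `where {return x = Nu; y >>= f = Nb}`. The bodies are closed apart from
their immediate arguments: `x` is the only variable of `Nu`; in `Nb`, the variable `y` has index
`1` and `f` has index `0`. -/
inductive Mon : Type
  | mk (Nu : Comp 1) (Nb : Comp 2) : Mon
end

mutual
def Val.rename : {m : ℕ} → Val m → {m' : ℕ} → (Fin m → Fin m') → Val m'
  | _, .var i, _, r => .var (r i)
  | _, .unit, _, _ => .unit
  | _, .pair V W, _, r => .pair (V.rename r) (W.rename r)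
  | _, .inj l V, _, r => .inj l (V.rename r)
  | _, .thunk M, _, r => .thunk (M.rename r)
def Comp.rename : {m : ℕ} → Comp m → {m' : ℕ} → (Fin m → Fin m') → Comp m'
  | _, .split V M, _, r => .split (V.rename r) (M.rename (liftR (liftR r)))
  | _, .vcase V k l M, _, r => .vcase (V.rename r) k l (fun i => (M i).rename (liftR r))
  | _, .force V, _, r => .force (V.rename r)
  | _, .ret V, _, r => .ret (V.rename r)
  | _, .seq M N, _, r => .seq (M.rename r) (N.rename (liftR r))
  | _, .lam M, _, r => .lam (M.rename (liftR r))
  | _, .app M V, _, r => .app (M.rename r) (V.rename r)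
  | _, .cpair M N, _, r => .cpair (M.rename r) (N.rename r)
  | _, .prj b M, _, r => .prj b (M.rename r)
  | _, .reify T N, _, r => .reify T (N.rename r)
  | _, .reflect N, _, r => .reflect (N.rename r)
end

/-- Lift a substitution of value terms under one binder. -/
def liftS {m m' : ℕ} (s : Fin m → Val m') : Fin (m + 1) → Val (m' + 1) :=
  push (.var 0) (fun i => (s i).rename Fin.succ)

mutual
/-- Simultaneous capture-avoiding substitution. -/
def Val.subst : {m : ℕ} → Val m → {m' : ℕ} → (Fin m → Val m') → Val m'
  | _, .var i, _, s => s i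
  | _, .unit, _, _ => .unit
  | _, .pair V W, _, s => .pair (V.subst s) (W.subst s)
  | _, .inj l V, _, s => .inj l (V.subst s)
  | _, .thunk M, _, s => .thunk (M.subst s)
def Comp.subst : {m : ℕ} → Comp m → {m' : ℕ} → (Fin m → Val m') → Comp m'
  | _, .split V M, _, s => .split (V.subst s) (M.subst (liftS (liftS s)))
  | _, .vcase V k l M, _, s => .vcase (V.subst s) k l (fun i => (M i).subst (liftS s))
  | _, .force V, _, s => .force (V.subst s)
  | _, .ret V, _, s => .ret (V.subst s)
  | _, .seq M N, _, s => .seq (M.subst s) (N.subst (liftS s))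
  | _, .lam M, _, s => .lam (M.subst (liftS s))
  | _, .app M V, _, s => .app (M.subst s) (V.subst s)
  | _, .cpair M N, _, s => .cpair (M.subst s) (N.subst s)
  | _, .prj b M, _, s => .prj b (M.subst s)
  | _, .reify T N, _, s => .reify T (N.subst s)
  | _, .reflect N, _, s => .reflect (N.subst s)
end

/-- `M[V/x]` for the variable `x` with index `0`. -/
def Comp.inst {m : ℕ} (M : Comp (m + 1)) (V : Val m) : Comp m :=
  M.subst (push V Val.var)

/-- `M[V₁/x₁, V₂/x₂]`, where `x₁` has index `1` and `x₂` has index `0`. -/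
def Comp.inst₂ {m : ℕ} (M : Comp (m + 2)) (V₁ V₂ : Val m) : Comp m :=
  M.subst (push V₂ (push V₁ Val.var))

/-! ### Operational semantics -/

/-- Basic frames `x ← [ ]; N`, `[ ] V` and `prj_i [ ]`. -/
inductive BasicFrame (m : ℕ) : Type
  | seq (N : Comp (m + 1)) : BasicFrame m
  | app (V : Val m) : BasicFrame m
  | prj (b : Bool) : BasicFrame m

def BasicFrame.plug {m : ℕ} : BasicFrame m → Comp m → Comp m
  | .seq N, M => .seq M N
  | .app V, M => .app M V
  | .prj b, M => .prj b M

def BasicFrame.rename {m m' : ℕ} (r : Fin m → Fin m') : BasicFrame m → BasicFrame m'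
  | .seq N => .seq (N.rename (liftR r))
  | .app V => .app (V.rename r)
  | .prj b => .prj b

/-- `H[M]` for a hoisting context `H`, a stack of basic frames listed outermost first. -/
def plugHoist {m : ℕ} (H : List (BasicFrame m)) (M : Comp m) : Comp m :=
  H.foldr BasicFrame.plug M

/-- Computation frames: basic frames and `[ [ ] ]^T`. -/
inductive Frame (m : ℕ) : Type
  | basic (B : BasicFrame m) : Frame m
  | reify (T : Mon) : Frame m

def Frame.plug {m : ℕ} : Frame m → Comp m → Comp m
  | .basic B, M => B.plug M
  | .reify T, M => .reify T M

/-- `C[M]` for an evaluation context `C`, a stack of frames listed outermost first. -/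
def plugEval {m : ℕ} (C : List (Frame m)) (M : Comp m) : Comp m :=
  C.foldr Frame.plug M

/-- Beta reduction. -/
inductive Beta {m : ℕ} : Comp m → Comp m → Prop
  | split (V₁ V₂ : Val m) (M : Comp (m + 2)) :
      Beta (.split (.pair V₁ V₂) M) (M.inst₂ V₁ V₂)
  | vcase (k : ℕ) (l : Fin k → ℕ) (i : Fin k) (V : Val m) (M : Fin k → Comp (m + 1)) :
      Beta (.vcase (.inj (l i) V) k l M) ((M i).inst V)
  | force (M : Comp m) : Beta (.force (.thunk M)) M
  | seq (V : Val m) (N : Comp (m + 1)) : Beta (.seq (.ret V) N) (N.inst V)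
  | app (M : Comp (m + 1)) (V : Val m) : Beta (.app (.lam M) V) (M.inst V)
  | prj (b : Bool) (M N : Comp m) : Beta (.prj b (.cpair M N)) (cond b M N)
  /-- `[return V]^T` reduces to `Nu[V/x]`. -/
  | reify (Nu : Comp 1) (Nb : Comp 2) (V : Val m) :
      Beta (.reify (.mk Nu Nb) (.ret V)) (Nu.subst (push V Fin.elim0))
  /-- `[H[μ(N)]]^T` reduces to `Nb[{N}/y, {λ x. [H[return x]]^T}/f]`. -/
  | reflect (Nu : Comp 1) (Nb : Comp 2) (H : List (BasicFrame m)) (N : Comp m) :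
      Beta (.reify (.mk Nu Nb) (plugHoist H (.reflect N)))
        (Nb.subst (push
          (.thunk (.lam (.reify (.mk Nu Nb)
            (plugHoist (H.map (BasicFrame.rename Fin.succ)) (.ret (.var 0))))))
          (push (.thunk N) Fin.elim0)))

/-- One-step reduction: beta reduction inside an evaluation context. -/
inductive Step {m : ℕ} : Comp m → Comp m → Prop
  | mk (C : List (Frame m)) {M N : Comp m} (h : Beta M N) : Step (plugEval C M) (plugEval C N)

/-- Reflexive-transitive closure of one-step reduction. -/
def Steps {m : ℕ} : Comp m → Comp m → Prop := Relation.ReflTransGen Step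

/-! ### Types and effects

`Eff n`, `VTy n` and `CTy n` are the (raw) effects, value types and computation types whose type
variables are among `n` variables. -/

mutual
/-- Effects: the empty effect, and `layer E C T`, the monad `T` on the type constructor `α. C`
layered on top of `E`, i.e. `E ≺ instance monad (α. C) T`; `α` has index `0` in `C`. -/
inductive Eff : ℕ → Type
  | pure {n : ℕ} : Eff n
  | layer {n : ℕ} (E : Eff n) (C : CTy (n + 1)) (T : Mon) : Eff n
/-- Value types. `variant k l A` is the variant type with labels `l i` at types `A i`, `i < k`. -/
inductive VTy : ℕ → Type
  | tvar {n : ℕ} (i : Fin n) : VTy n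
  | unit {n : ℕ} : VTy n
  | prod {n : ℕ} (A B : VTy n) : VTy n
  | variant {n : ℕ} (k : ℕ) (l : Fin k → ℕ) (A : Fin k → VTy n) : VTy n
  | U {n : ℕ} (E : Eff n) (C : CTy n) : VTy n
/-- Computation types: returners, functions, and computation products. -/
inductive CTy : ℕ → Type
  | F {n : ℕ} (A : VTy n) : CTy n
  | fn {n : ℕ} (A : VTy n) (C : CTy n) : CTy n
  | prod {n : ℕ} (C D : CTy n) : CTy n
end

mutual
def Eff.rename : {n : ℕ} → Eff n → {n' : ℕ} → (Fin n → Fin n') → Eff n'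
  | _, .pure, _, _ => .pure
  | _, .layer E C T, _, r => .layer (E.rename r) (C.rename (liftR r)) T
def VTy.rename : {n : ℕ} → VTy n → {n' : ℕ} → (Fin n → Fin n') → VTy n'
  | _, .tvar i, _, r => .tvar (r i)
  | _, .unit, _, _ => .unit
  | _, .prod A B, _, r => .prod (A.rename r) (B.rename r)
  | _, .variant k l A, _, r => .variant k l (fun i => (A i).rename r)
  | _, .U E C, _, r => .U (E.rename r) (C.rename r)
def CTy.rename : {n : ℕ} → CTy n → {n' : ℕ} → (Fin n → Fin n') → CTy n'
  | _, .F A, _, r => .F (A.rename r)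
  | _, .fn A C, _, r => .fn (A.rename r) (C.rename r)
  | _, .prod C D, _, r => .prod (C.rename r) (D.rename r)
end

/-- Lift a substitution of value types under one binder. -/
def liftT {n n' : ℕ} (s : Fin n → VTy n') : Fin (n + 1) → VTy (n' + 1) :=
  push (.tvar 0) (fun i => (s i).rename Fin.succ)

mutual
def Eff.subst : {n : ℕ} → Eff n → {n' : ℕ} → (Fin n → VTy n') → Eff n'
  | _, .pure, _, _ => .pure
  | _, .layer E C T, _, s => .layer (E.subst s) (C.subst (liftT s)) T
def VTy.subst : {n : ℕ} → VTy n → {n' : ℕ} → (Fin n → VTy n') → VTy n'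
  | _, .tvar i, _, s => s i
  | _, .unit, _, _ => .unit
  | _, .prod A B, _, s => .prod (A.subst s) (B.subst s)
  | _, .variant k l A, _, s => .variant k l (fun i => (A i).subst s)
  | _, .U E C, _, s => .U (E.subst s) (C.subst s)
def CTy.subst : {n : ℕ} → CTy n → {n' : ℕ} → (Fin n → VTy n') → CTy n'
  | _, .F A, _, s => .F (A.subst s)
  | _, .fn A C, _, s => .fn (A.subst s) (C.subst s)
  | _, .prod C D, _, s => .prod (C.subst s) (D.subst s)
end

/-- `C[A/α]` for the type variable `α` with index `0`. -/
def CTy.inst {n : ℕ} (C : CTy (n + 1)) (A : VTy n) : CTy n :=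
  C.subst (push A VTy.tvar)

/-- Weakening of an effect by one type variable. -/
def Eff.wk {n : ℕ} (E : Eff n) : Eff (n + 1) := E.rename Fin.succ

/-- In the type environment `Θ, α₁, α₂`, where `α₁` has index `1` and `α₂` has index `0`:
`C[α₁/α]`, for `C` in the type environment `Θ, α`. -/
def CTy.at₁ {n : ℕ} (C : CTy (n + 1)) : CTy (n + 2) :=
  C.rename (push 1 (fun i => i.succ.succ))

/-- In the type environment `Θ, α₁, α₂`: `C[α₂/α]`, for `C` in the type environment `Θ, α`. -/
def CTy.at₂ {n : ℕ} (C : CTy (n + 1)) : CTy (n + 2) :=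
  C.rename (push 0 (fun i => i.succ.succ))

/-- The environment `x : α` in which the body of a return is typed. -/
def ctxRet {n : ℕ} : Fin 1 → VTy (n + 1) := push (.tvar 0) Fin.elim0

/-- The environment `y : U_E C[α₁/α], f : U_E (α₁ → C[α₂/α])`, over the type environment
`Θ, α₁, α₂`, in which the body of a bind is typed. -/
def ctxBind {n : ℕ} (E : Eff n) (C : CTy (n + 1)) : Fin 2 → VTy (n + 2) :=
  push (.U E.wk.wk (.fn (.tvar 1) C.at₂)) (push (.U E.wk.wk C.at₁) Fin.elim0)

/-! ### Kinding and typing derivations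

Kinding and typing judgements are defined simultaneously, because well-kindedness of a monad
involves typing of its return and bind. Derivations are data, because the denotational semantics
is defined on derivations. An environment `Γ` assigns value types to `m` term variables.
The conditions that the environment, the effect and the type of a typing judgement are well-kinded
are premises of those rules in which they do not follow from the other premises. -/

mutual
/-- Derivations of `Θ ⊢ E : Eff`. -/
inductive KEff : {n : ℕ} → Eff n → Type
  | pure {n : ℕ} : KEff (Eff.pure : Eff n)
  | layer {n : ℕ} {E : Eff n} {C : CTy (n + 1)} {Nu : Comp 1} {Nb : Comp 2}
      (kE : KEff E) (kC : KComp E.wk C)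
      (du : DComp ctxRet E.wk Nu C) (db : DComp (ctxBind E C) E.wk.wk Nb C.at₂) :
      KEff (Eff.layer E C (.mk Nu Nb))
/-- Derivations of `Θ ⊢ A : Val`. The labels of a variant type are listed in strictly increasing
order: this is the canonical representation of a finite map from labels to types. -/
inductive KVal : {n : ℕ} → VTy n → Type
  | tvar {n : ℕ} (i : Fin n) : KVal (VTy.tvar i)
  | unit {n : ℕ} : KVal (VTy.unit : VTy n)
  | prod {n : ℕ} {A B : VTy n} (kA : KVal A) (kB : KVal B) : KVal (VTy.prod A B)
  | variant {n : ℕ} {k : ℕ} {l : Fin k → ℕ} {A : Fin k → VTy n} (hl : StrictMono l)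
      (kA : ∀ i, KVal (A i)) : KVal (VTy.variant k l A)
  | U {n : ℕ} {E : Eff n} {C : CTy n} (kE : KEff E) (kC : KComp E C) : KVal (VTy.U E C)
/-- Derivations of `Θ ⊢ C : Comp_E`, for a well-kinded effect `E`. -/
inductive KComp : {n : ℕ} → Eff n → CTy n → Type
  | F {n : ℕ} {E : Eff n} {A : VTy n} (kA : KVal A) : KComp E (CTy.F A)
  | fn {n : ℕ} {E : Eff n} {A : VTy n} {C : CTy n} (kA : KVal A) (kC : KComp E C) :
      KComp E (CTy.fn A C)
  | prod {n : ℕ} {E : Eff n} {C D : CTy n} (kC : KComp E C) (kD : KComp E D) :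
      KComp E (CTy.prod C D)
/-- Derivations of `Θ; Γ ⊢ V : A`. -/
inductive DVal : {n m : ℕ} → (Fin m → VTy n) → Val m → VTy n → Type
  | var {n m : ℕ} {Γ : Fin m → VTy n} (kΓ : ∀ j, KVal (Γ j)) (i : Fin m) :
      DVal Γ (Val.var i) (Γ i)
  | unit {n m : ℕ} {Γ : Fin m → VTy n} (kΓ : ∀ j, KVal (Γ j)) : DVal Γ Val.unit VTy.unit
  | pair {n m : ℕ} {Γ : Fin m → VTy n} {V W : Val m} {A B : VTy n}
      (dV : DVal Γ V A) (dW : DVal Γ W B) : DVal Γ (Val.pair V W) (VTy.prod A B)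
  | inj {n m : ℕ} {Γ : Fin m → VTy n} {V : Val m} {k : ℕ} {l : Fin k → ℕ} {A : Fin k → VTy n}
      (kA : KVal (VTy.variant k l A)) (i : Fin k) (dV : DVal Γ V (A i)) :
      DVal Γ (Val.inj (l i) V) (VTy.variant k l A)
  | thunk {n m : ℕ} {Γ : Fin m → VTy n} {M : Comp m} {E : Eff n} {C : CTy n}
      (dM : DComp Γ E M C) : DVal Γ (Val.thunk M) (VTy.U E C)
/-- Derivations of `Θ; Γ ⊢_E M : C`. -/
inductive DComp : {n m : ℕ} → (Fin m → VTy n) → Eff n → Comp m → CTy n → Type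
  | split {n m : ℕ} {Γ : Fin m → VTy n} {E : Eff n} {V : Val m} {M : Comp (m + 2)}
      {A B : VTy n} {C : CTy n}
      (dV : DVal Γ V (VTy.prod A B)) (dM : DComp (push B (push A Γ)) E M C) :
      DComp Γ E (Comp.split V M) C
  | vcase {n m : ℕ} {Γ : Fin m → VTy n} {E : Eff n} {V : Val m} {k : ℕ} {l : Fin k → ℕ}
      {M : Fin k → Comp (m + 1)} {A : Fin k → VTy n} {C : CTy n}
      (kE : KEff E) (kC : KComp E C) (dV : DVal Γ V (VTy.variant k l A))
      (dM : ∀ i, DComp (push (A i) Γ) E (M i) C) : DComp Γ E (Comp.vcase V k l M) C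
  | force {n m : ℕ} {Γ : Fin m → VTy n} {E : Eff n} {V : Val m} {C : CTy n}
      (dV : DVal Γ V (VTy.U E C)) : DComp Γ E (Comp.force V) C
  | ret {n m : ℕ} {Γ : Fin m → VTy n} {E : Eff n} {V : Val m} {A : VTy n}
      (kE : KEff E) (dV : DVal Γ V A) : DComp Γ E (Comp.ret V) (CTy.F A)
  | seq {n m : ℕ} {Γ : Fin m → VTy n} {E : Eff n} {M : Comp m} {N : Comp (m + 1)}
      {A : VTy n} {C : CTy n} (kE : KEff E)
      (dM : DComp Γ E M (CTy.F A)) (dN : DComp (push A Γ) E N C) :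
      DComp Γ E (Comp.seq M N) C
  | lam {n m : ℕ} {Γ : Fin m → VTy n} {E : Eff n} {M : Comp (m + 1)} {A : VTy n} {C : CTy n}
      (dM : DComp (push A Γ) E M C) : DComp Γ E (Comp.lam M) (CTy.fn A C)
  | app {n m : ℕ} {Γ : Fin m → VTy n} {E : Eff n} {M : Comp m} {V : Val m} {A : VTy n} {C : CTy n}
      (dM : DComp Γ E M (CTy.fn A C)) (dV : DVal Γ V A) : DComp Γ E (Comp.app M V) C
  | cpair {n m : ℕ} {Γ : Fin m → VTy n} {E : Eff n} {M N : Comp m} {C D : CTy n}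
      (dM : DComp Γ E M C) (dN : DComp Γ E N D) : DComp Γ E (Comp.cpair M N) (CTy.prod C D)
  | fst {n m : ℕ} {Γ : Fin m → VTy n} {E : Eff n} {M : Comp m} {C D : CTy n}
      (dM : DComp Γ E M (CTy.prod C D)) : DComp Γ E (Comp.prj true M) C
  | snd {n m : ℕ} {Γ : Fin m → VTy n} {E : Eff n} {M : Comp m} {C D : CTy n}
      (dM : DComp Γ E M (CTy.prod C D)) : DComp Γ E (Comp.prj false M) D
  | reify {n m : ℕ} {Γ : Fin m → VTy n} {E : Eff n} {C : CTy (n + 1)} {T : Mon} {N : Comp m}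
      {A : VTy n} (kT : KEff (Eff.layer E C T)) (dN : DComp Γ (Eff.layer E C T) N (CTy.F A)) :
      DComp Γ E (Comp.reify T N) (C.inst A)
  | reflect {n m : ℕ} {Γ : Fin m → VTy n} {E : Eff n} {C : CTy (n + 1)} {T : Mon} {N : Comp m}
      {A : VTy n} (kT : KEff (Eff.layer E C T)) (kA : KVal A) (dN : DComp Γ E N (C.inst A)) :
      DComp Γ (Eff.layer E C T) (Comp.reflect N) (CTy.F A)
end

/-! ### Denotations of types

Sets are modelled by the types in a universe `Type u`. The sets denoted by types depend only on the
raw types; the monad structure of an effect is given by derivations, below. -/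

mutual
/-- The type constructor `T_E` of the monad denoted by an effect. -/
def Eff.T : {n : ℕ} → Eff n → (Fin n → Type u) → Type u → Type u
  | _, .pure, _, X => X
  | _, .layer E C _, θ, X => C.car (push X θ) (E.T θ)
/-- The set denoted by a value type. -/
def VTy.car : {n : ℕ} → VTy n → (Fin n → Type u) → Type u
  | _, .tvar i, θ => θ i
  | _, .unit, _ => PUnit
  | _, .prod A B, θ => A.car θ × B.car θ
  | _, .variant k _ A, θ => Σ i : Fin k, (A i).car θ
  | _, .U E C, θ => C.car θ (E.T θ)
/-- The carrier of the algebra denoted by an `E`-computation type, given the type constructor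
`T = T_E`. -/
def CTy.car : {n : ℕ} → CTy n → (Fin n → Type u) → (Type u → Type u) → Type u
  | _, .F A, θ, T => T (A.car θ)
  | _, .fn A C, θ, T => A.car θ → C.car θ T
  | _, .prod C D, θ, T => C.car θ T × D.car θ T
end

/-- The set denoted by an environment. -/
abbrev Env {n m : ℕ} (Γ : Fin m → VTy n) (θ : Fin n → Type u) : Type u := ∀ i, (Γ i).car θ

def Env.push {n m : ℕ} {Γ : Fin m → VTy n} {θ : Fin n → Type u} {A : VTy n}
    (a : A.car θ) (γ : Env Γ θ) : Env (LMon.push A Γ) θ :=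
  fun i => Fin.cases (motive := fun i => (LMon.push A Γ i).car θ) a γ i

theorem push_comp_liftR {n n' : ℕ} (r : Fin n → Fin n') (θ : Fin n' → Type u) (X : Type u) :
    (fun i => push X θ (liftR r i)) = push X (fun i => θ (r i)) := by
  funext i
  refine Fin.cases ?_ (fun j => ?_) i <;> rfl

mutual
theorem Eff.T_rename : {n : ℕ} → (E : Eff n) → {n' : ℕ} → (r : Fin n → Fin n') →
    (θ : Fin n' → Type u) → (E.rename r).T θ = E.T (fun i => θ (r i))
  | _, .pure, _, _, _ => by funext X; simp only [Eff.rename, Eff.T]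
  | _, .layer E C _, _, r, θ => by
      funext X
      simp only [Eff.rename, Eff.T]
      rw [CTy.car_rename C, push_comp_liftR, Eff.T_rename E]
theorem VTy.car_rename : {n : ℕ} → (A : VTy n) → {n' : ℕ} → (r : Fin n → Fin n') →
    (θ : Fin n' → Type u) → (A.rename r).car θ = A.car (fun i => θ (r i))
  | _, .tvar _, _, _, _ => by simp only [VTy.rename, VTy.car]
  | _, .unit, _, _, _ => by simp only [VTy.rename, VTy.car]
  | _, .prod A B, _, r, θ => by
      simp only [VTy.rename, VTy.car]
      rw [VTy.car_rename A, VTy.car_rename B]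
  | _, .variant k _ A, _, r, θ => by
      simp only [VTy.rename, VTy.car]
      rw [funext (fun i => VTy.car_rename (A i) r θ)]
  | _, .U E C, _, r, θ => by
      simp only [VTy.rename, VTy.car]
      rw [CTy.car_rename C, Eff.T_rename E]
theorem CTy.car_rename : {n : ℕ} → (C : CTy n) → {n' : ℕ} → (r : Fin n → Fin n') →
    (θ : Fin n' → Type u) → (T : Type u → Type u) →
    (C.rename r).car θ T = C.car (fun i => θ (r i)) T
  | _, .F A, _, r, θ, T => by
      simp only [CTy.rename, CTy.car]
      rw [VTy.car_rename A]
  | _, .fn A C, _, r, θ, T => by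
      simp only [CTy.rename, CTy.car]
      rw [VTy.car_rename A, CTy.car_rename C]
  | _, .prod C D, _, r, θ, T => by
      simp only [CTy.rename, CTy.car]
      rw [CTy.car_rename C, CTy.car_rename D]
end

theorem car_liftT {n n' : ℕ} (s : Fin n → VTy n') (θ : Fin n' → Type u) (X : Type u) :
    (fun i => (liftT s i).car (push X θ)) = push X (fun i => (s i).car θ) := by
  funext i
  refine Fin.cases ?_ (fun j => ?_) i
  · show (VTy.tvar 0).car (push X θ) = X
    simp only [VTy.car]; rfl
  · show ((s j).rename Fin.succ).car (push X θ) = (s j).car θ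
    rw [VTy.car_rename]; rfl

mutual
theorem Eff.T_subst : {n : ℕ} → (E : Eff n) → {n' : ℕ} → (s : Fin n → VTy n') →
    (θ : Fin n' → Type u) → (E.subst s).T θ = E.T (fun i => (s i).car θ)
  | _, .pure, _, _, _ => by funext X; simp only [Eff.subst, Eff.T]
  | _, .layer E C _, _, s, θ => by
      funext X
      simp only [Eff.subst, Eff.T]
      rw [CTy.car_subst C, car_liftT, Eff.T_subst E]
theorem VTy.car_subst : {n : ℕ} → (A : VTy n) → {n' : ℕ} → (s : Fin n → VTy n') →
    (θ : Fin n' → Type u) → (A.subst s).car θ = A.car (fun i => (s i).car θ)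
  | _, .tvar _, _, _, _ => by simp only [VTy.subst, VTy.car]
  | _, .unit, _, _, _ => by simp only [VTy.subst, VTy.car]
  | _, .prod A B, _, s, θ => by
      simp only [VTy.subst, VTy.car]
      rw [VTy.car_subst A, VTy.car_subst B]
  | _, .variant k _ A, _, s, θ => by
      simp only [VTy.subst, VTy.car]
      rw [funext (fun i => VTy.car_subst (A i) s θ)]
  | _, .U E C, _, s, θ => by
      simp only [VTy.subst, VTy.car]
      rw [CTy.car_subst C, Eff.T_subst E]
theorem CTy.car_subst : {n : ℕ} → (C : CTy n) → {n' : ℕ} → (s : Fin n → VTy n') →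
    (θ : Fin n' → Type u) → (T : Type u → Type u) →
    (C.subst s).car θ T = C.car (fun i => (s i).car θ) T
  | _, .F A, _, s, θ, T => by
      simp only [CTy.subst, CTy.car]
      rw [VTy.car_subst A]
  | _, .fn A C, _, s, θ, T => by
      simp only [CTy.subst, CTy.car]
      rw [VTy.car_subst A, CTy.car_subst C]
  | _, .prod C D, _, s, θ, T => by
      simp only [CTy.subst, CTy.car]
      rw [CTy.car_subst C, CTy.car_subst D]
end

theorem Eff.T_wk {n : ℕ} (E : Eff n) (θ : Fin n → Type u) (X : Type u) :
    E.wk.T (push X θ) = E.T θ := Eff.T_rename E Fin.succ (push X θ)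

theorem Eff.T_wk_wk {n : ℕ} (E : Eff n) (θ : Fin n → Type u) (X Y : Type u) :
    E.wk.wk.T (push Y (push X θ)) = E.T θ := by
  rw [Eff.T_wk, Eff.T_wk]

/-- The carrier in which the body of a return is interpreted. -/
theorem car_ret {n : ℕ} (E : Eff n) (C : CTy (n + 1)) (θ : Fin n → Type u) (X : Type u) :
    C.car (push X θ) (E.wk.T (push X θ)) = C.car (push X θ) (E.T θ) := by
  rw [Eff.T_wk]

theorem car_at₁ {n : ℕ} (E : Eff n) (C : CTy (n + 1)) (θ : Fin n → Type u) (X Y : Type u) :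
    C.at₁.car (push Y (push X θ)) (E.wk.wk.T (push Y (push X θ))) = C.car (push X θ) (E.T θ) := by
  rw [Eff.T_wk_wk, CTy.at₁, CTy.car_rename]
  congr 1
  funext i
  refine Fin.cases ?_ (fun j => ?_) i <;> rfl

theorem car_at₂ {n : ℕ} (E : Eff n) (C : CTy (n + 1)) (θ : Fin n → Type u) (X Y : Type u) :
    C.at₂.car (push Y (push X θ)) (E.wk.wk.T (push Y (push X θ))) = C.car (push Y θ) (E.T θ) := by
  rw [Eff.T_wk_wk, CTy.at₂, CTy.car_rename]
  congr 1
  funext i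
  refine Fin.cases ?_ (fun j => ?_) i <;> rfl

/-- `|⟦C[A/α]⟧_θ| = |⟦C⟧_{θ[α ↦ ⟦A⟧_θ]}|`. -/
theorem car_inst {n : ℕ} (C : CTy (n + 1)) (A : VTy n) (θ : Fin n → Type u) (T : Type u → Type u) :
    (C.inst A).car θ T = C.car (push (A.car θ) θ) T := by
  rw [CTy.inst, CTy.car_subst]
  congr 1
  funext i
  refine Fin.cases ?_ (fun j => ?_) i
  · rfl
  · show (VTy.tvar j).car θ = θ j
    simp only [VTy.car]

/-! ### Monads and algebras -/

/-- The data of a return and a bind on a type constructor, without any laws. -/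
structure RetBind (T : Type u → Type u) : Type (u + 1) where
  ret : ∀ {X : Type u}, X → T X
  bind : ∀ {X Y : Type u}, T X → (X → T Y) → T Y

/-- The monad laws. -/
structure RetBind.IsMonad {T : Type u → Type u} (μ : RetBind T) : Prop where
  ret_bind : ∀ {X Y : Type u} (x : X) (f : X → T Y), μ.bind (μ.ret x) f = f x
  bind_ret : ∀ {X : Type u} (t : T X), μ.bind t (fun x => μ.ret x) = t
  bind_bind : ∀ {X Y Z : Type u} (t : T X) (f : X → T Y) (g : Y → T Z),
    μ.bind (μ.bind t f) g = μ.bind t (fun x => μ.bind (f x) g)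

/-- The functorial action. -/
def RetBind.fmap {T : Type u → Type u} (μ : RetBind T) {X Y : Type u} (f : X → Y) (t : T X) : T Y :=
  μ.bind t (fun x => μ.ret (f x))

/-- The algebra structure denoted by a computation type: the free algebra for returners, and
the pointwise and componentwise structures for functions and products. -/
def CTy.alg {T : Type u → Type u} (μ : RetBind T) :
    {n : ℕ} → (C : CTy n) → (θ : Fin n → Type u) → T (C.car θ T) → C.car θ T
  | _, .F A, θ => fun (t : T (T (A.car θ))) => μ.bind t (fun x => x)
  | _, .fn A C, θ => fun (t : T (A.car θ → C.car θ T)) (a : A.car θ) =>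
      C.alg μ θ (μ.fmap (fun h => h a) t)
  | _, .prod C D, θ => fun (t : T (C.car θ T × D.car θ T)) =>
      (C.alg μ θ (μ.fmap Prod.fst t), D.alg μ θ (μ.fmap Prod.snd t))

/-- The Kleisli extension of `f : X → |⟦C⟧|` to a function `T X → |⟦C⟧|`. -/
def CTy.kext {T : Type u → Type u} (μ : RetBind T) {n : ℕ} (C : CTy n) (θ : Fin n → Type u)
    {X : Type u} (t : T X) (f : X → C.car θ T) : C.car θ T :=
  C.alg μ θ (μ.fmap f t)

/-! ### Denotations of derivations

The partial semantics of derivations is given by the domain of definition (`Defined`, below)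
together with the values (`retDen`, `bindDen` and `den`); the values are meaningful where they are defined. -/

mutual
/-- The return denoted by an effect: the identity for the empty effect, and the denotation of the
body of the return, at `θ[α ↦ X]`, for a layer. -/
def KEff.retDen : {n : ℕ} → {E : Eff n} → KEff E → (θ : Fin n → Type u) → (X : Type u) →
    X → E.T θ X
  | _, _, .pure, _, _ => fun x => x
  | _, _, .layer (E := E) (C := C) _ _ du _, θ, X => fun x =>
      cast (car_ret E C θ X)
        (du.den (push X θ) (Env.push (A := .tvar 0) (x : (push X θ) 0) (fun i => i.elim0)))
/-- The bind denoted by an effect: application for the empty effect, and the denotation of the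
body of the bind, at `θ[α₁ ↦ X, α₂ ↦ Y]`, for a layer. -/
def KEff.bindDen : {n : ℕ} → {E : Eff n} → KEff E → (θ : Fin n → Type u) → (X Y : Type u) →
    E.T θ X → (X → E.T θ Y) → E.T θ Y
  | _, _, .pure, _, _, _ => fun x f => f x
  | _, _, .layer (E := E) (C := C) _ _ _ db, θ, X, Y => fun t f =>
      cast (car_at₂ E C θ X Y)
        (db.den (push Y (push X θ))
          (Env.push (A := .U E.wk.wk (.fn (.tvar 1) C.at₂))
            (fun (x : X) => cast (car_at₂ E C θ X Y).symm (f x))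
            (Env.push (A := .U E.wk.wk C.at₁)
              (cast (car_at₁ E C θ X Y).symm t) (fun i => i.elim0))))
/-- The function denoted by a value term derivation. -/
def DVal.den : {n m : ℕ} → {Γ : Fin m → VTy n} → {V : Val m} → {A : VTy n} →
    DVal Γ V A → (θ : Fin n → Type u) → Env Γ θ → A.car θ
  | _, _, _, _, _, .var (Γ := Γ) _ i, _, γ => γ i
  | _, _, _, _, _, .unit _, _, _ => PUnit.unit
  | _, _, _, _, _, .pair dV dW, θ, γ => (dV.den θ γ, dW.den θ γ)
  | _, _, _, _, _, .inj (A := A) _ i dV, θ, γ =>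
      (⟨i, dV.den θ γ⟩ : Σ i, (A i).car θ)
  | _, _, _, _, _, .thunk dM, θ, γ => dM.den θ γ
/-- The function denoted by a computation term derivation. -/
def DComp.den : {n m : ℕ} → {Γ : Fin m → VTy n} → {E : Eff n} → {M : Comp m} → {C : CTy n} →
    DComp Γ E M C → (θ : Fin n → Type u) → Env Γ θ → C.car θ (E.T θ)
  | _, _, _, _, _, _, .split (A := A) (B := B) dV dM, θ, γ =>
      let p : A.car θ × B.car θ := dV.den θ γ
      dM.den θ (Env.push p.2 (Env.push p.1 γ))
  | _, _, _, _, _, _, .vcase (A := A) _ _ dV dM, θ, γ =>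
      let p : Σ i, (A i).car θ := dV.den θ γ
      (dM p.1).den θ (Env.push p.2 γ)
  | _, _, _, _, _, _, .force dV, θ, γ => dV.den θ γ
  | _, _, _, _, _, _, .ret kE dV, θ, γ => kE.retDen θ _ (dV.den θ γ)
  | _, _, _, _, _, C, .seq kE dM dN, θ, γ =>
      C.kext ⟨fun {X} x => kE.retDen θ X x, fun {X Y} t f => kE.bindDen θ X Y t f⟩ θ (dM.den θ γ) (fun a => dN.den θ (Env.push a γ))
  | _, _, _, _, _, _, .lam (A := A) dM, θ, γ => fun (a : A.car θ) => dM.den θ (Env.push a γ)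
  | _, _, _, E, _, _, .app (A := A) (C := C) dM dV, θ, γ =>
      (dM.den θ γ : A.car θ → C.car θ (E.T θ)) (dV.den θ γ)
  | _, _, _, _, _, _, .cpair dM dN, θ, γ => (dM.den θ γ, dN.den θ γ)
  | _, _, _, E, _, _, .fst (C := C) (D := D) dM, θ, γ =>
      (dM.den θ γ : C.car θ (E.T θ) × D.car θ (E.T θ)).1
  | _, _, _, E, _, _, .snd (C := C) (D := D) dM, θ, γ =>
      (dM.den θ γ : C.car θ (E.T θ) × D.car θ (E.T θ)).2
  | _, _, _, _, _, _, .reify (E := E) (C := C) (A := A) _ dN, θ, γ =>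
      cast (car_inst C A θ (E.T θ)).symm (dN.den θ γ)
  | _, _, _, _, _, _, .reflect (E := E) (C := C) (A := A) _ _ dN, θ, γ =>
      cast (car_inst C A θ (E.T θ)) (dN.den θ γ)
end

/-- The return and bind denoted by an effect. -/
def KEff.mon {n : ℕ} {E : Eff n} (kE : KEff E) (θ : Fin n → Type u) : RetBind (E.T θ) where
  ret {X} x := kE.retDen θ X x
  bind {X Y} t f := kE.bindDen θ X Y t f

mutual
/-- The denotation of an effect derivation is defined: the denotations of all sub-derivations are
defined, and each layer denotes a monad. -/
def KEff.Defined : {n : ℕ} → {E : Eff n} → KEff E → (Fin n → Type u) → Prop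
  | _, _, .pure, _ => True
  | _, _, .layer kE kC du db, θ =>
      kE.Defined θ ∧ (∀ X : Type u, kC.Defined (push X θ)) ∧
      (∀ X : Type u, du.Defined (push X θ)) ∧
      (∀ X Y : Type u, db.Defined (push Y (push X θ))) ∧
      ((KEff.layer kE kC du db).mon θ).IsMonad
def KVal.Defined : {n : ℕ} → {A : VTy n} → KVal A → (Fin n → Type u) → Prop
  | _, _, .tvar _, _ => True
  | _, _, .unit, _ => True
  | _, _, .prod kA kB, θ => kA.Defined θ ∧ kB.Defined θ
  | _, _, .variant _ kA, θ => ∀ i, (kA i).Defined θ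
  | _, _, .U kE kC, θ => kE.Defined θ ∧ kC.Defined θ
def KComp.Defined : {n : ℕ} → {E : Eff n} → {C : CTy n} → KComp E C → (Fin n → Type u) → Prop
  | _, _, _, .F kA, θ => kA.Defined θ
  | _, _, _, .fn kA kC, θ => kA.Defined θ ∧ kC.Defined θ
  | _, _, _, .prod kC kD, θ => kC.Defined θ ∧ kD.Defined θ
/-- The denotation of a value term derivation is defined. -/
def DVal.Defined : {n m : ℕ} → {Γ : Fin m → VTy n} → {V : Val m} → {A : VTy n} →
    DVal Γ V A → (Fin n → Type u) → Prop
  | _, _, _, _, _, .var (Γ := Γ) kΓ _, θ => ∀ j, (kΓ j).Defined θ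
  | _, _, _, _, _, .unit kΓ, θ => ∀ j, (kΓ j).Defined θ
  | _, _, _, _, _, .pair dV dW, θ => dV.Defined θ ∧ dW.Defined θ
  | _, _, _, _, _, .inj kA _ dV, θ => kA.Defined θ ∧ dV.Defined θ
  | _, _, _, _, _, .thunk dM, θ => dM.Defined θ
/-- The denotation of a computation term derivation is defined. -/
def DComp.Defined : {n m : ℕ} → {Γ : Fin m → VTy n} → {E : Eff n} → {M : Comp m} → {C : CTy n} →
    DComp Γ E M C → (Fin n → Type u) → Prop
  | _, _, _, _, _, _, .split dV dM, θ => dV.Defined θ ∧ dM.Defined θ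
  | _, _, _, _, _, _, .vcase kE kC dV dM, θ =>
      kE.Defined θ ∧ kC.Defined θ ∧ dV.Defined θ ∧ ∀ i, (dM i).Defined θ
  | _, _, _, _, _, _, .force dV, θ => dV.Defined θ
  | _, _, _, _, _, _, .ret kE dV, θ => kE.Defined θ ∧ dV.Defined θ
  | _, _, _, _, _, _, .seq kE dM dN, θ => kE.Defined θ ∧ dM.Defined θ ∧ dN.Defined θ
  | _, _, _, _, _, _, .lam dM, θ => dM.Defined θ
  | _, _, _, _, _, _, .app dM dV, θ => dM.Defined θ ∧ dV.Defined θ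
  | _, _, _, _, _, _, .cpair dM dN, θ => dM.Defined θ ∧ dN.Defined θ
  | _, _, _, _, _, _, .fst dM, θ => dM.Defined θ
  | _, _, _, _, _, _, .snd dM, θ => dM.Defined θ
  | _, _, _, _, _, _, .reify kT dN, θ => kT.Defined θ ∧ dN.Defined θ
  | _, _, _, _, _, _, .reflect kT kA dN, θ => kT.Defined θ ∧ kA.Defined θ ∧ dN.Defined θ
end

/-- A proper derivation: the denotation is defined for all type variable assignments. -/
def DVal.Proper {n m : ℕ} {Γ : Fin m → VTy n} {V : Val m} {A : VTy n} (d : DVal Γ V A) : Prop :=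
  ∀ θ : Fin n → Type u, d.Defined θ

/-- A proper derivation: the denotation is defined for all type variable assignments. -/
def DComp.Proper {n m : ℕ} {Γ : Fin m → VTy n} {E : Eff n} {M : Comp m} {C : CTy n}
    (d : DComp Γ E M C) : Prop :=
  ∀ θ : Fin n → Type u, d.Defined θ

/-- `Θ; Γ ⊢ V : A` is a well-typed proper value term: it has a proper derivation. -/
def ProperVal {n m : ℕ} (Γ : Fin m → VTy n) (V : Val m) (A : VTy n) : Prop :=
  ∃ d : DVal Γ V A, DVal.Proper.{u} d

/-- `Θ; Γ ⊢_E M : C` is a well-typed proper computation term: it has a proper derivation. -/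
def ProperComp {n m : ℕ} (Γ : Fin m → VTy n) (E : Eff n) (M : Comp m) (C : CTy n) : Prop :=
  ∃ d : DComp Γ E M C, DComp.Proper.{u} d

/-! ### Plugged contexts and contextual equivalence -/

/-- Sets of tuples `⟨Θ, Γ, V₁, V₂, A⟩`. -/
abbrev ValTuples := ∀ ⦃n m : ℕ⦄, (Fin m → VTy n) → Val m → Val m → VTy n → Prop

/-- Sets of tuples `⟨Θ, Γ, E, M₁, M₂, C⟩`. -/
abbrev CompTuples := ∀ ⦃n m : ℕ⦄, (Fin m → VTy n) → Eff n → Comp m → Comp m → CTy n → Prop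

mutual
/-- The value tuples in the smallest set of tuples of proper terms that contains the tuples in
`BV` and `BC` and is compatible with the typing rules. -/
inductive PlugVal (BV : ValTuples) (BC : CompTuples) :
    {n m : ℕ} → (Fin m → VTy n) → Val m → Val m → VTy n → Prop
  | base {n m : ℕ} {Γ : Fin m → VTy n} {V V' : Val m} {A : VTy n} (h : BV Γ V V' A)
      (p : ProperVal.{u} Γ V A) (p' : ProperVal.{u} Γ V' A) : PlugVal BV BC Γ V V' A
  | var {n m : ℕ} {Γ : Fin m → VTy n} (i : Fin m) (p : ProperVal.{u} Γ (Val.var i) (Γ i)) :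
      PlugVal BV BC Γ (Val.var i) (Val.var i) (Γ i)
  | unit {n m : ℕ} {Γ : Fin m → VTy n} (p : ProperVal.{u} Γ Val.unit VTy.unit) :
      PlugVal BV BC Γ Val.unit Val.unit VTy.unit
  | pair {n m : ℕ} {Γ : Fin m → VTy n} {V V' W W' : Val m} {A B : VTy n}
      (hV : PlugVal BV BC Γ V V' A) (hW : PlugVal BV BC Γ W W' B)
      (p : ProperVal.{u} Γ (Val.pair V W) (VTy.prod A B))
      (p' : ProperVal.{u} Γ (Val.pair V' W') (VTy.prod A B)) :
      PlugVal BV BC Γ (Val.pair V W) (Val.pair V' W') (VTy.prod A B)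
  | inj {n m : ℕ} {Γ : Fin m → VTy n} {V V' : Val m} {k : ℕ} {l : Fin k → ℕ} {A : Fin k → VTy n}
      (i : Fin k) (hV : PlugVal BV BC Γ V V' (A i))
      (p : ProperVal.{u} Γ (Val.inj (l i) V) (VTy.variant k l A))
      (p' : ProperVal.{u} Γ (Val.inj (l i) V') (VTy.variant k l A)) :
      PlugVal BV BC Γ (Val.inj (l i) V) (Val.inj (l i) V') (VTy.variant k l A)
  | thunk {n m : ℕ} {Γ : Fin m → VTy n} {M M' : Comp m} {E : Eff n} {C : CTy n}
      (hM : PlugComp BV BC Γ E M M' C)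
      (p : ProperVal.{u} Γ (Val.thunk M) (VTy.U E C))
      (p' : ProperVal.{u} Γ (Val.thunk M') (VTy.U E C)) :
      PlugVal BV BC Γ (Val.thunk M) (Val.thunk M') (VTy.U E C)
/-- The computation tuples in the smallest set of tuples of proper terms that contains the tuples
in `BV` and `BC` and is compatible with the typing rules. -/
inductive PlugComp (BV : ValTuples) (BC : CompTuples) :
    {n m : ℕ} → (Fin m → VTy n) → Eff n → Comp m → Comp m → CTy n → Prop
  | base {n m : ℕ} {Γ : Fin m → VTy n} {E : Eff n} {M M' : Comp m} {C : CTy n}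
      (h : BC Γ E M M' C) (p : ProperComp.{u} Γ E M C) (p' : ProperComp.{u} Γ E M' C) :
      PlugComp BV BC Γ E M M' C
  | split {n m : ℕ} {Γ : Fin m → VTy n} {E : Eff n} {V V' : Val m} {M M' : Comp (m + 2)}
      {A B : VTy n} {C : CTy n}
      (hV : PlugVal BV BC Γ V V' (VTy.prod A B))
      (hM : PlugComp BV BC (push B (push A Γ)) E M M' C)
      (p : ProperComp.{u} Γ E (Comp.split V M) C) (p' : ProperComp.{u} Γ E (Comp.split V' M') C) :
      PlugComp BV BC Γ E (Comp.split V M) (Comp.split V' M') C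
  | vcase {n m : ℕ} {Γ : Fin m → VTy n} {E : Eff n} {V V' : Val m} {k : ℕ} {l : Fin k → ℕ}
      {M M' : Fin k → Comp (m + 1)} {A : Fin k → VTy n} {C : CTy n}
      (hV : PlugVal BV BC Γ V V' (VTy.variant k l A))
      (hM : ∀ i, PlugComp BV BC (push (A i) Γ) E (M i) (M' i) C)
      (p : ProperComp.{u} Γ E (Comp.vcase V k l M) C)
      (p' : ProperComp.{u} Γ E (Comp.vcase V' k l M') C) :
      PlugComp BV BC Γ E (Comp.vcase V k l M) (Comp.vcase V' k l M') C
  | force {n m : ℕ} {Γ : Fin m → VTy n} {E : Eff n} {V V' : Val m} {C : CTy n}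
      (hV : PlugVal BV BC Γ V V' (VTy.U E C))
      (p : ProperComp.{u} Γ E (Comp.force V) C) (p' : ProperComp.{u} Γ E (Comp.force V') C) :
      PlugComp BV BC Γ E (Comp.force V) (Comp.force V') C
  | ret {n m : ℕ} {Γ : Fin m → VTy n} {E : Eff n} {V V' : Val m} {A : VTy n}
      (hV : PlugVal BV BC Γ V V' A)
      (p : ProperComp.{u} Γ E (Comp.ret V) (CTy.F A))
      (p' : ProperComp.{u} Γ E (Comp.ret V') (CTy.F A)) :
      PlugComp BV BC Γ E (Comp.ret V) (Comp.ret V') (CTy.F A)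
  | seq {n m : ℕ} {Γ : Fin m → VTy n} {E : Eff n} {M M' : Comp m} {N N' : Comp (m + 1)}
      {A : VTy n} {C : CTy n}
      (hM : PlugComp BV BC Γ E M M' (CTy.F A)) (hN : PlugComp BV BC (push A Γ) E N N' C)
      (p : ProperComp.{u} Γ E (Comp.seq M N) C) (p' : ProperComp.{u} Γ E (Comp.seq M' N') C) :
      PlugComp BV BC Γ E (Comp.seq M N) (Comp.seq M' N') C
  | lam {n m : ℕ} {Γ : Fin m → VTy n} {E : Eff n} {M M' : Comp (m + 1)} {A : VTy n} {C : CTy n}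
      (hM : PlugComp BV BC (push A Γ) E M M' C)
      (p : ProperComp.{u} Γ E (Comp.lam M) (CTy.fn A C))
      (p' : ProperComp.{u} Γ E (Comp.lam M') (CTy.fn A C)) :
      PlugComp BV BC Γ E (Comp.lam M) (Comp.lam M') (CTy.fn A C)
  | app {n m : ℕ} {Γ : Fin m → VTy n} {E : Eff n} {M M' : Comp m} {V V' : Val m} {A : VTy n}
      {C : CTy n} (hM : PlugComp BV BC Γ E M M' (CTy.fn A C)) (hV : PlugVal BV BC Γ V V' A)
      (p : ProperComp.{u} Γ E (Comp.app M V) C) (p' : ProperComp.{u} Γ E (Comp.app M' V') C) :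
      PlugComp BV BC Γ E (Comp.app M V) (Comp.app M' V') C
  | cpair {n m : ℕ} {Γ : Fin m → VTy n} {E : Eff n} {M M' N N' : Comp m} {C D : CTy n}
      (hM : PlugComp BV BC Γ E M M' C) (hN : PlugComp BV BC Γ E N N' D)
      (p : ProperComp.{u} Γ E (Comp.cpair M N) (CTy.prod C D))
      (p' : ProperComp.{u} Γ E (Comp.cpair M' N') (CTy.prod C D)) :
      PlugComp BV BC Γ E (Comp.cpair M N) (Comp.cpair M' N') (CTy.prod C D)
  | fst {n m : ℕ} {Γ : Fin m → VTy n} {E : Eff n} {M M' : Comp m} {C D : CTy n}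
      (hM : PlugComp BV BC Γ E M M' (CTy.prod C D))
      (p : ProperComp.{u} Γ E (Comp.prj true M) C) (p' : ProperComp.{u} Γ E (Comp.prj true M') C) :
      PlugComp BV BC Γ E (Comp.prj true M) (Comp.prj true M') C
  | snd {n m : ℕ} {Γ : Fin m → VTy n} {E : Eff n} {M M' : Comp m} {C D : CTy n}
      (hM : PlugComp BV BC Γ E M M' (CTy.prod C D))
      (p : ProperComp.{u} Γ E (Comp.prj false M) D)
      (p' : ProperComp.{u} Γ E (Comp.prj false M') D) :
      PlugComp BV BC Γ E (Comp.prj false M) (Comp.prj false M') D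
  | reify {n m : ℕ} {Γ : Fin m → VTy n} {E : Eff n} {C : CTy (n + 1)} {T : Mon} {N N' : Comp m}
      {A : VTy n} (hN : PlugComp BV BC Γ (Eff.layer E C T) N N' (CTy.F A))
      (p : ProperComp.{u} Γ E (Comp.reify T N) (C.inst A))
      (p' : ProperComp.{u} Γ E (Comp.reify T N') (C.inst A)) :
      PlugComp BV BC Γ E (Comp.reify T N) (Comp.reify T N') (C.inst A)
  | reflect {n m : ℕ} {Γ : Fin m → VTy n} {E : Eff n} {C : CTy (n + 1)} {T : Mon} {N N' : Comp m}
      {A : VTy n} (hN : PlugComp BV BC Γ E N N' (C.inst A))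
      (p : ProperComp.{u} Γ (Eff.layer E C T) (Comp.reflect N) (CTy.F A))
      (p' : ProperComp.{u} Γ (Eff.layer E C T) (Comp.reflect N') (CTy.F A)) :
      PlugComp BV BC Γ (Eff.layer E C T) (Comp.reflect N) (Comp.reflect N') (CTy.F A)
end

/-- No value tuples. -/
def noVal : ValTuples := fun _ _ _ _ _ _ => False

/-- No computation tuples. -/
def noComp : CompTuples := fun _ _ _ _ _ _ _ => False

/-- The tuples `⟨Θ, Γ, V₁, V₂, A⟩` for `Θ` extending `Θ₀` and `Γ` extending `Γ₀`. With de Bruijn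
indices, an extension is an injection `r` of the type variables together with an injection `ρ` of
the term variables that preserves types. -/
def holeVal {n₀ m₀ : ℕ} (Γ₀ : Fin m₀ → VTy n₀) (V₁ V₂ : Val m₀) (A₀ : VTy n₀) : ValTuples :=
  fun n m Γ V V' A => ∃ (r : Fin n₀ → Fin n) (ρ : Fin m₀ → Fin m),
    Function.Injective r ∧ Function.Injective ρ ∧ (∀ i, Γ (ρ i) = (Γ₀ i).rename r) ∧
    V = V₁.rename ρ ∧ V' = V₂.rename ρ ∧ A = A₀.rename r

/-- The tuples `⟨Θ, Γ, E₀, M₁, M₂, C₀⟩` for `Θ` extending `Θ₀` and `Γ` extending `Γ₀`. -/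
def holeComp {n₀ m₀ : ℕ} (Γ₀ : Fin m₀ → VTy n₀) (E₀ : Eff n₀) (M₁ M₂ : Comp m₀) (C₀ : CTy n₀) :
    CompTuples :=
  fun n m Γ E M M' C => ∃ (r : Fin n₀ → Fin n) (ρ : Fin m₀ → Fin m),
    Function.Injective r ∧ Function.Injective ρ ∧ (∀ i, Γ (ρ i) = (Γ₀ i).rename r) ∧
    E = E₀.rename r ∧ M = M₁.rename ρ ∧ M' = M₂.rename ρ ∧ C = C₀.rename r

/-- Ground types. -/
inductive Ground : VTy 0 → Prop
  | unit : Ground VTy.unit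
  | prod {G H : VTy 0} (hG : Ground G) (hH : Ground H) : Ground (VTy.prod G H)
  | variant {k : ℕ} {l : Fin k → ℕ} {G : Fin k → VTy 0} (hl : StrictMono l)
      (hG : ∀ i, Ground (G i)) : Ground (VTy.variant k l G)

/-- Closed ground-returner pure plugged contexts, with holes filled as `BV` and `BC` prescribe,
reduce to the same ground values. -/
def SameResults (BV : ValTuples) (BC : CompTuples) : Prop :=
  ∀ (G : VTy 0) (MP MQ : Comp 0), Ground G →
    PlugComp.{u} BV BC (Fin.elim0 : Fin 0 → VTy 0) Eff.pure MP MQ (CTy.F G) →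
    ∀ V : Val 0, Nonempty (DVal (Fin.elim0 : Fin 0 → VTy 0) V G) →
      (Steps MP (Comp.ret V) ↔ Steps MQ (Comp.ret V))

/-- Contextual equivalence of value terms `Θ; Γ ⊢ V, W : A`. -/
def CtxEquivVal {n m : ℕ} (Γ : Fin m → VTy n) (V W : Val m) (A : VTy n) : Prop :=
  SameResults.{u} (holeVal Γ V W A) noComp

/-- Contextual equivalence of computation terms `Θ; Γ ⊢_E M, N : C`. -/
def CtxEquivComp {n m : ℕ} (Γ : Fin m → VTy n) (E : Eff n) (M N : Comp m) (C : CTy n) : Prop :=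
  SameResults.{u} noVal (holeComp Γ E M N C)

end LMon

-- The proof uses a logical relation between closed terms and elements of the denoted sets. Every
-- proper term is related to its denotation. At a ground returner type of the empty effect, being
-- related means evaluating to a value that codes the element, and a ground element has at most one
-- code. Two terms related to the same element therefore have the same result.
--
-- The difficulty lies in user-defined effects. A raw effect fixes only a type constructor; its
-- return and bind come from a derivation, and terms and contexts may use different derivations of
-- the same effect. The relation is therefore defined on raw types and cannot mention the
-- denotational bind. `layerLift` uses a realizer of bind instead. For `M` to be related to `t`, the
-- term `[M]^T` must be related to `t`. Moreover, for `N` related to `t` and a continuation realized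
-- by `[H[return x]]^T`, every element related to `Nb[{N}/y, {λ x. [H[return x]]^T}/f]` must also be
-- related to `[H[M]]^T`.
--
-- In practice both of these terms are known to be related to `bind t k`, and the first also to a
-- further element `s`. Concluding that the second is related to `s` is exactly zigzag-completeness.
-- Type variables are therefore interpreted by zigzag-complete relations only, and `CTy.rel_zigzag`
-- and its companions carry this property to all types.
--
-- The monad laws supplied by properness then do the work: left unit for `return`, associativity for
-- sequencing (`MonModel.adequate`), right unit for reflection (`MonModel.reflect`). `CTy.rel_kext`
-- extends sequencing from free algebras to all computation types. Return and bind bodies are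
-- polymorphic, so the fundamental lemma (`DComp.compRel`) quantifies over all zigzag-complete
-- interpretations of type variables, and `monModel_of_compRel` instantiates it at the relations
-- that a layer needs.
--
-- For plugged contexts, no denotations of derivations are compared: `PlugComp.compPair` shows that
-- both plugged terms realize one common function.

namespace LMon

/-! ### Renaming and substitution -/

@[simp] theorem push_zero {α : Sort*} {n : ℕ} (a : α) (f : Fin n → α) : push a f 0 = a := rfl

@[simp] theorem push_succ {α : Sort*} {n : ℕ} (a : α) (f : Fin n → α) (i : Fin n) :
    push a f i.succ = f i := rfl

theorem liftR_liftR {n n' n'' : ℕ} (r : Fin n → Fin n') (r' : Fin n' → Fin n'') :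
    (fun i => liftR r' (liftR r i)) = liftR (fun i => r' (r i)) := by
  funext i
  refine Fin.cases rfl (fun _ => rfl) i

theorem liftS_liftR {m m' m'' : ℕ} (r : Fin m → Fin m') (s : Fin m' → Val m'') :
    (fun i => liftS s (liftR r i)) = liftS (fun i => s (r i)) := by
  funext i
  refine Fin.cases rfl (fun _ => rfl) i

theorem liftS_var {m : ℕ} : liftS (Val.var : Fin m → Val m) = Val.var := by
  funext i
  refine Fin.cases rfl (fun _ => ?_) i
  simp only [liftS, push_succ, Val.rename]

mutual
theorem Val.rename_rename : {m : ℕ} → (V : Val m) → {m' m'' : ℕ} → (r : Fin m → Fin m') →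
    (r' : Fin m' → Fin m'') → (V.rename r).rename r' = V.rename (fun i => r' (r i))
  | _, .var _, _, _, _, _ => by simp only [Val.rename]
  | _, .unit, _, _, _, _ => by simp only [Val.rename]
  | _, .pair V W, _, _, r, r' => by
      simp only [Val.rename, Val.rename_rename V, Val.rename_rename W]
  | _, .inj _ V, _, _, r, r' => by simp only [Val.rename, Val.rename_rename V]
  | _, .thunk M, _, _, r, r' => by simp only [Val.rename, Comp.rename_rename M]
theorem Comp.rename_rename : {m : ℕ} → (M : Comp m) → {m' m'' : ℕ} → (r : Fin m → Fin m') →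
    (r' : Fin m' → Fin m'') → (M.rename r).rename r' = M.rename (fun i => r' (r i))
  | _, .split V M, _, _, r, r' => by
      simp only [Comp.rename, Val.rename_rename V, Comp.rename_rename M, liftR_liftR]
  | _, .vcase V k l M, _, _, r, r' => by
      simp only [Comp.rename, Val.rename_rename V]
      exact congrArg _ (funext fun i => by rw [Comp.rename_rename (M i), liftR_liftR])
  | _, .force V, _, _, r, r' => by simp only [Comp.rename, Val.rename_rename V]
  | _, .ret V, _, _, r, r' => by simp only [Comp.rename, Val.rename_rename V]
  | _, .seq M N, _, _, r, r' => by
      simp only [Comp.rename, Comp.rename_rename M, Comp.rename_rename N, liftR_liftR]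
  | _, .lam M, _, _, r, r' => by simp only [Comp.rename, Comp.rename_rename M, liftR_liftR]
  | _, .app M V, _, _, r, r' => by
      simp only [Comp.rename, Comp.rename_rename M, Val.rename_rename V]
  | _, .cpair M N, _, _, r, r' => by
      simp only [Comp.rename, Comp.rename_rename M, Comp.rename_rename N]
  | _, .prj _ M, _, _, r, r' => by simp only [Comp.rename, Comp.rename_rename M]
  | _, .reify _ N, _, _, r, r' => by simp only [Comp.rename, Comp.rename_rename N]
  | _, .reflect N, _, _, r, r' => by simp only [Comp.rename, Comp.rename_rename N]
end

mutual
theorem Val.subst_rename : {m : ℕ} → (V : Val m) → {m' m'' : ℕ} → (r : Fin m → Fin m') →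
    (s : Fin m' → Val m'') → (V.rename r).subst s = V.subst (fun i => s (r i))
  | _, .var _, _, _, _, _ => by simp only [Val.rename, Val.subst]
  | _, .unit, _, _, _, _ => by simp only [Val.rename, Val.subst]
  | _, .pair V W, _, _, r, s => by
      simp only [Val.rename, Val.subst, Val.subst_rename V, Val.subst_rename W]
  | _, .inj _ V, _, _, r, s => by simp only [Val.rename, Val.subst, Val.subst_rename V]
  | _, .thunk M, _, _, r, s => by simp only [Val.rename, Val.subst, Comp.subst_rename M]
theorem Comp.subst_rename : {m : ℕ} → (M : Comp m) → {m' m'' : ℕ} → (r : Fin m → Fin m') →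
    (s : Fin m' → Val m'') → (M.rename r).subst s = M.subst (fun i => s (r i))
  | _, .split V M, _, _, r, s => by
      simp only [Comp.rename, Comp.subst, Val.subst_rename V, Comp.subst_rename M, liftS_liftR]
  | _, .vcase V k l M, _, _, r, s => by
      simp only [Comp.rename, Comp.subst, Val.subst_rename V]
      exact congrArg _ (funext fun i => by rw [Comp.subst_rename (M i), liftS_liftR])
  | _, .force V, _, _, r, s => by simp only [Comp.rename, Comp.subst, Val.subst_rename V]
  | _, .ret V, _, _, r, s => by simp only [Comp.rename, Comp.subst, Val.subst_rename V]
  | _, .seq M N, _, _, r, s => by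
      simp only [Comp.rename, Comp.subst, Comp.subst_rename M, Comp.subst_rename N, liftS_liftR]
  | _, .lam M, _, _, r, s => by
      simp only [Comp.rename, Comp.subst, Comp.subst_rename M, liftS_liftR]
  | _, .app M V, _, _, r, s => by
      simp only [Comp.rename, Comp.subst, Comp.subst_rename M, Val.subst_rename V]
  | _, .cpair M N, _, _, r, s => by
      simp only [Comp.rename, Comp.subst, Comp.subst_rename M, Comp.subst_rename N]
  | _, .prj _ M, _, _, r, s => by simp only [Comp.rename, Comp.subst, Comp.subst_rename M]
  | _, .reify _ N, _, _, r, s => by simp only [Comp.rename, Comp.subst, Comp.subst_rename N]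
  | _, .reflect N, _, _, r, s => by simp only [Comp.rename, Comp.subst, Comp.subst_rename N]
end

theorem liftS_rename {m m' m'' : ℕ} (s : Fin m → Val m') (r : Fin m' → Fin m'') :
    (fun i => (liftS s i).rename (liftR r)) = liftS (fun i => (s i).rename r) := by
  funext i
  refine Fin.cases ?_ (fun j => ?_) i
  · simp only [liftS, push_zero, Val.rename]; rfl
  · simp only [liftS, push_succ, Val.rename_rename]; rfl

mutual
theorem Val.rename_subst : {m : ℕ} → (V : Val m) → {m' m'' : ℕ} → (s : Fin m → Val m') →
    (r : Fin m' → Fin m'') → (V.subst s).rename r = V.subst (fun i => (s i).rename r)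
  | _, .var _, _, _, _, _ => by simp only [Val.subst]
  | _, .unit, _, _, _, _ => by simp only [Val.rename, Val.subst]
  | _, .pair V W, _, _, s, r => by
      simp only [Val.rename, Val.subst, Val.rename_subst V, Val.rename_subst W]
  | _, .inj _ V, _, _, s, r => by simp only [Val.rename, Val.subst, Val.rename_subst V]
  | _, .thunk M, _, _, s, r => by simp only [Val.rename, Val.subst, Comp.rename_subst M]
theorem Comp.rename_subst : {m : ℕ} → (M : Comp m) → {m' m'' : ℕ} → (s : Fin m → Val m') →
    (r : Fin m' → Fin m'') → (M.subst s).rename r = M.subst (fun i => (s i).rename r)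
  | _, .split V M, _, _, s, r => by
      simp only [Comp.rename, Comp.subst, Val.rename_subst V, Comp.rename_subst M, liftS_rename]
  | _, .vcase V k l M, _, _, s, r => by
      simp only [Comp.rename, Comp.subst, Val.rename_subst V]
      exact congrArg _ (funext fun i => by rw [Comp.rename_subst (M i), liftS_rename])
  | _, .force V, _, _, s, r => by simp only [Comp.rename, Comp.subst, Val.rename_subst V]
  | _, .ret V, _, _, s, r => by simp only [Comp.rename, Comp.subst, Val.rename_subst V]
  | _, .seq M N, _, _, s, r => by
      simp only [Comp.rename, Comp.subst, Comp.rename_subst M, Comp.rename_subst N, liftS_rename]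
  | _, .lam M, _, _, s, r => by
      simp only [Comp.rename, Comp.subst, Comp.rename_subst M, liftS_rename]
  | _, .app M V, _, _, s, r => by
      simp only [Comp.rename, Comp.subst, Comp.rename_subst M, Val.rename_subst V]
  | _, .cpair M N, _, _, s, r => by
      simp only [Comp.rename, Comp.subst, Comp.rename_subst M, Comp.rename_subst N]
  | _, .prj _ M, _, _, s, r => by simp only [Comp.rename, Comp.subst, Comp.rename_subst M]
  | _, .reify _ N, _, _, s, r => by simp only [Comp.rename, Comp.subst, Comp.rename_subst N]
  | _, .reflect N, _, _, s, r => by simp only [Comp.rename, Comp.subst, Comp.rename_subst N]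
end

theorem liftS_subst {m m' m'' : ℕ} (s : Fin m → Val m') (t : Fin m' → Val m'') :
    (fun i => (liftS s i).subst (liftS t)) = liftS (fun i => (s i).subst t) := by
  funext i
  refine Fin.cases ?_ (fun j => ?_) i
  · simp only [liftS, push_zero, Val.subst]
  · simp only [liftS, push_succ, Val.subst_rename, Val.rename_subst]

mutual
theorem Val.subst_subst : {m : ℕ} → (V : Val m) → {m' m'' : ℕ} → (s : Fin m → Val m') →
    (t : Fin m' → Val m'') → (V.subst s).subst t = V.subst (fun i => (s i).subst t)
  | _, .var _, _, _, _, _ => by simp only [Val.subst]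
  | _, .unit, _, _, _, _ => by simp only [Val.subst]
  | _, .pair V W, _, _, s, t => by
      simp only [Val.subst, Val.subst_subst V, Val.subst_subst W]
  | _, .inj _ V, _, _, s, t => by simp only [Val.subst, Val.subst_subst V]
  | _, .thunk M, _, _, s, t => by simp only [Val.subst, Comp.subst_subst M]
theorem Comp.subst_subst : {m : ℕ} → (M : Comp m) → {m' m'' : ℕ} → (s : Fin m → Val m') →
    (t : Fin m' → Val m'') → (M.subst s).subst t = M.subst (fun i => (s i).subst t)
  | _, .split V M, _, _, s, t => by
      simp only [Comp.subst, Val.subst_subst V, Comp.subst_subst M, liftS_subst]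
  | _, .vcase V k l M, _, _, s, t => by
      simp only [Comp.subst, Val.subst_subst V]
      exact congrArg _ (funext fun i => by rw [Comp.subst_subst (M i), liftS_subst])
  | _, .force V, _, _, s, t => by simp only [Comp.subst, Val.subst_subst V]
  | _, .ret V, _, _, s, t => by simp only [Comp.subst, Val.subst_subst V]
  | _, .seq M N, _, _, s, t => by
      simp only [Comp.subst, Comp.subst_subst M, Comp.subst_subst N, liftS_subst]
  | _, .lam M, _, _, s, t => by simp only [Comp.subst, Comp.subst_subst M, liftS_subst]
  | _, .app M V, _, _, s, t => by
      simp only [Comp.subst, Comp.subst_subst M, Val.subst_subst V]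
  | _, .cpair M N, _, _, s, t => by
      simp only [Comp.subst, Comp.subst_subst M, Comp.subst_subst N]
  | _, .prj _ M, _, _, s, t => by simp only [Comp.subst, Comp.subst_subst M]
  | _, .reify _ N, _, _, s, t => by simp only [Comp.subst, Comp.subst_subst N]
  | _, .reflect N, _, _, s, t => by simp only [Comp.subst, Comp.subst_subst N]
end

mutual
theorem Val.subst_var : {m : ℕ} → (V : Val m) → V.subst Val.var = V
  | _, .var _ => by simp only [Val.subst]
  | _, .unit => by simp only [Val.subst]
  | _, .pair V W => by simp only [Val.subst, Val.subst_var V, Val.subst_var W]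
  | _, .inj _ V => by simp only [Val.subst, Val.subst_var V]
  | _, .thunk M => by simp only [Val.subst, Comp.subst_var M]
theorem Comp.subst_var : {m : ℕ} → (M : Comp m) → M.subst Val.var = M
  | _, .split V M => by simp only [Comp.subst, Val.subst_var V, liftS_var, Comp.subst_var M]
  | _, .vcase V k l M => by
      simp only [Comp.subst, Val.subst_var V, liftS_var, fun i => Comp.subst_var (M i)]
  | _, .force V => by simp only [Comp.subst, Val.subst_var V]
  | _, .ret V => by simp only [Comp.subst, Val.subst_var V]
  | _, .seq M N => by simp only [Comp.subst, liftS_var, Comp.subst_var M, Comp.subst_var N]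
  | _, .lam M => by simp only [Comp.subst, liftS_var, Comp.subst_var M]
  | _, .app M V => by simp only [Comp.subst, Comp.subst_var M, Val.subst_var V]
  | _, .cpair M N => by simp only [Comp.subst, Comp.subst_var M, Comp.subst_var N]
  | _, .prj _ M => by simp only [Comp.subst, Comp.subst_var M]
  | _, .reify _ N => by simp only [Comp.subst, Comp.subst_var N]
  | _, .reflect N => by simp only [Comp.subst, Comp.subst_var N]
end

theorem Val.subst_rename_succ {m : ℕ} (V W : Val m) :
    (V.rename Fin.succ).subst (push W Val.var) = V := by
  rw [Val.subst_rename]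
  exact Val.subst_var V

/-- Substituting under a binder and then contracting the redex amounts to one extended substitution.
This matches β-reducts with the closing substitutions of semantic typing. -/
theorem Comp.inst_subst_liftS {m m' : ℕ} (M : Comp (m + 1)) (s : Fin m → Val m') (V : Val m') :
    (M.subst (liftS s)).inst V = M.subst (push V s) := by
  rw [Comp.inst, Comp.subst_subst]
  congr 1
  funext i
  refine Fin.cases ?_ (fun j => ?_) i
  · simp only [liftS, push_zero, Val.subst]
  · simp only [liftS, push_succ, Val.subst_rename_succ]

theorem Comp.inst₂_subst_liftS {m m' : ℕ} (M : Comp (m + 2)) (s : Fin m → Val m') (V W : Val m') :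
    (M.subst (liftS (liftS s))).inst₂ V W = M.subst (push W (push V s)) := by
  rw [Comp.inst₂, Comp.subst_subst]
  congr 1
  funext i
  refine Fin.cases ?_ (fun j => ?_) i
  · simp only [liftS, push_zero, Val.subst]
  · refine Fin.cases ?_ (fun j => ?_) j
    · simp only [liftS, push_zero, push_succ, Val.subst_rename, Val.subst]
    · simp only [liftS, push_succ, Val.subst_rename]
      exact Val.subst_var _

theorem BasicFrame.plug_rename_subst {m : ℕ} (B : BasicFrame m) (M : Comp (m + 1)) (V : Val m) :
    ((B.rename Fin.succ).plug M).subst (push V Val.var) =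
      B.plug (M.subst (push V Val.var)) := by
  have h : ∀ i : Fin m, push V Val.var i.succ = Val.var i := fun _ => rfl
  cases B with
  | seq N =>
      simp only [BasicFrame.rename, BasicFrame.plug, Comp.subst, Comp.subst_rename, liftS_liftR, h]
      rw [liftS_var, Comp.subst_var]
  | app W => simp only [BasicFrame.rename, BasicFrame.plug, Comp.subst, Val.subst_rename_succ]
  | prj b => simp only [BasicFrame.rename, BasicFrame.plug, Comp.subst]

/-- The frames are weakened when they move under `λ x`, so instantiating `x` leaves them as they
were. -/
theorem plugHoist_rename_inst {m : ℕ} (H : List (BasicFrame m)) (V : Val m) :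
    (plugHoist (H.map (BasicFrame.rename Fin.succ)) (.ret (.var 0))).inst V =
      plugHoist H (.ret V) := by
  induction H with
  | nil =>
      simp only [plugHoist, List.map_nil, List.foldr_nil, Comp.inst, Comp.subst, Val.subst]
      rfl
  | cons B H ih =>
      exact (BasicFrame.plug_rename_subst B _ V).trans (congrArg B.plug ih)

/-! ### Deterministic steps -/

/-- `M` reduces in one step to `M'` and to nothing else. -/
def DStep {m : ℕ} (M M' : Comp m) : Prop := ∀ X, Step M X ↔ X = M'

def DSteps {m : ℕ} : Comp m → Comp m → Prop := Relation.ReflTransGen DStep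

-- Unique decomposition into evaluation context and redex

theorem Step.of_beta {m : ℕ} {M N : Comp m} (h : Beta M N) : Step M N := Step.mk [] h

theorem Step.plug {m : ℕ} (F : Frame m) {M N : Comp m} (h : Step M N) :
    Step (F.plug M) (F.plug N) := by
  cases h with
  | mk C h => exact Step.mk (F :: C) h

theorem Step.beta_or_plug {m : ℕ} {M X : Comp m} (h : Step M X) :
    Beta M X ∨ ∃ (F : Frame m) (N N' : Comp m), M = F.plug N ∧ X = F.plug N' ∧ Step N N' := by
  cases h with
  | mk C h =>
      cases C with
      | nil => exact Or.inl h
      | cons F C => exact Or.inr ⟨F, _, _, rfl, rfl, Step.mk C h⟩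

theorem not_step_ret {m : ℕ} {V : Val m} {X : Comp m} : ¬ Step (.ret V) X := by
  intro h
  obtain h | ⟨F, N, N', h, -, -⟩ := h.beta_or_plug
  · cases h
  · rcases F with (_ | _ | _) | _ <;> cases h

theorem not_step_lam {m : ℕ} {M : Comp (m + 1)} {X : Comp m} : ¬ Step (.lam M) X := by
  intro h
  obtain h | ⟨F, N, N', h, -, -⟩ := h.beta_or_plug
  · cases h
  · rcases F with (_ | _ | _) | _ <;> cases h

theorem not_step_cpair {m : ℕ} {M N X : Comp m} : ¬ Step (.cpair M N) X := by
  intro h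
  obtain h | ⟨F, N, N', h, -, -⟩ := h.beta_or_plug
  · cases h
  · rcases F with (_ | _ | _) | _ <;> cases h

theorem plugHoist_reflect_ne_ret {m : ℕ} (H : List (BasicFrame m)) (N : Comp m) (V : Val m) :
    plugHoist H (.reflect N) ≠ .ret V := by
  rcases H with _ | ⟨_ | _ | _, H⟩ <;> intro h <;> cases h

theorem BasicFrame.plug_inj {m : ℕ} {B B' : BasicFrame m} {M M' : Comp m}
    (h : B.plug M = B'.plug M') : B = B' ∧ M = M' := by
  rcases B with _ | _ | _ <;> rcases B' with _ | _ | _ <;>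
    simp only [BasicFrame.plug, Comp.seq.injEq, Comp.app.injEq, Comp.prj.injEq, reduceCtorEq]
      at h <;> simp [h]

/-- The head constructor determines the outermost frame, and `reflect` is not a frame, so the stack
can be read off from outside in. The redex of the reflection rule thus determines its contractum. -/
theorem plugHoist_reflect_inj {m : ℕ} {H H' : List (BasicFrame m)} {N N' : Comp m}
    (h : plugHoist H (.reflect N) = plugHoist H' (.reflect N')) : H = H' ∧ N = N' := by
  induction H generalizing H' with
  | nil =>
      rcases H' with _ | ⟨_ | _ | _, H'⟩ <;> cases h
      exact ⟨rfl, rfl⟩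
  | cons B H ih =>
      cases H' with
      | nil => rcases B with _ | _ | _ <;> cases h
      | cons B' H' =>
          obtain ⟨rfl, h'⟩ := BasicFrame.plug_inj (B := B) (B' := B') h
          obtain ⟨rfl, rfl⟩ := ih h'
          exact ⟨rfl, rfl⟩

theorem Frame.plug_eq_basic {m : ℕ} {F : Frame m} {B : BasicFrame m} {M N : Comp m}
    (h : F.plug M = B.plug N) : F = .basic B ∧ M = N := by
  rcases F with (_ | _ | _) | _ <;> rcases B with _ | _ | _ <;>
    simp only [Frame.plug, BasicFrame.plug, Comp.seq.injEq, Comp.app.injEq, Comp.prj.injEq,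
      reduceCtorEq] at h <;> simp [h]

theorem not_beta_plug_plugHoist_reflect {m : ℕ} {B : BasicFrame m} {H : List (BasicFrame m)}
    {N X : Comp m} : ¬ Beta (B.plug (plugHoist H (.reflect N))) X := by
  intro h
  generalize hM : plugHoist H (.reflect N) = M at h
  rcases H with _ | ⟨_ | _ | _, H⟩ <;> simp only [plugHoist, List.foldr, BasicFrame.plug] at hM <;>
    subst hM <;> rcases B with _ | _ | _ <;> cases h

/-- A reflection is inert until a reification encloses it: basic frames never meet a redex of their
own around it. -/
theorem not_step_plugHoist_reflect {m : ℕ} {H : List (BasicFrame m)} {N X : Comp m} :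
    ¬ Step (plugHoist H (.reflect N)) X := by
  induction H generalizing X with
  | nil =>
      intro h
      obtain h | ⟨F, N, N', h, -, -⟩ := h.beta_or_plug
      · cases h
      · rcases F with (_ | _ | _) | _ <;> cases h
  | cons B H ih =>
      intro h
      obtain h | ⟨F, M, M', h, -, hs⟩ := h.beta_or_plug
      · exact not_beta_plug_plugHoist_reflect h
      · obtain ⟨-, rfl⟩ := Frame.plug_eq_basic h.symm
        exact ih hs

/-- In a redex with a frame at its head, the argument of the frame is `return`, `λ`, a pair or
`H[μ(N)]`, and none of these reduces. A head redex therefore excludes any step below it. -/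
theorem Beta.not_step_of_plug {m : ℕ} {F : Frame m} {M X Y : Comp m} (h : Beta (F.plug M) X) :
    ¬ Step M Y := by
  rcases F with (_ | _ | _) | T <;> generalize hM : Frame.plug _ M = P at h <;> cases h <;>
    cases hM
  · exact not_step_ret
  · exact not_step_lam
  · exact not_step_cpair
  · exact not_step_ret
  · exact not_step_plugHoist_reflect

theorem Frame.plug_inj {m : ℕ} {F F' : Frame m} {M M' : Comp m}
    (h : F.plug M = F'.plug M') : F = F' ∧ M = M' := by
  rcases F with (_ | _ | _) | _ <;> rcases F' with (_ | _ | _) | _ <;>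
    simp only [Frame.plug, BasicFrame.plug, Comp.seq.injEq, Comp.app.injEq, Comp.prj.injEq,
      Comp.reify.injEq, reduceCtorEq] at h <;> simp [h]

theorem DStep.plug {m : ℕ} (F : Frame m) {M M' : Comp m} (h : DStep M M') :
    DStep (F.plug M) (F.plug M') := by
  intro X
  constructor
  · intro hX
    obtain hb | ⟨F', N, N', e, rfl, hs⟩ := hX.beta_or_plug
    · exact absurd ((h M').2 rfl) hb.not_step_of_plug
    · obtain ⟨rfl, rfl⟩ := Frame.plug_inj e
      rw [(h N').1 hs]
  · rintro rfl
    exact ((h M').2 rfl).plug F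

theorem DSteps.plug {m : ℕ} (F : Frame m) {M M' : Comp m} (h : DSteps M M') :
    DSteps (F.plug M) (F.plug M') := by
  induction h with
  | refl => exact Relation.ReflTransGen.refl
  | tail _ h ih => exact Relation.ReflTransGen.tail ih (h.plug F)

theorem DStep.plugHoist {m : ℕ} (H : List (BasicFrame m)) {M M' : Comp m} (h : DStep M M') :
    DStep (plugHoist H M) (plugHoist H M') := by
  induction H with
  | nil => exact h
  | cons B H ih => exact ih.plug (.basic B)

theorem DSteps.plugHoist {m : ℕ} (H : List (BasicFrame m)) {M M' : Comp m} (h : DSteps M M') :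
    DSteps (plugHoist H M) (plugHoist H M') := by
  induction h with
  | refl => exact Relation.ReflTransGen.refl
  | tail _ h ih => exact Relation.ReflTransGen.tail ih (h.plugHoist H)

-- Determinism of the β-rules

theorem DStep.of_beta {m : ℕ} {M N : Comp m} (h : Beta M N) (u : ∀ X, Beta M X → X = N) :
    DStep M N := by
  intro X
  constructor
  · intro hX
    obtain hb | ⟨F', P, P', rfl, rfl, hs⟩ := hX.beta_or_plug
    · exact u X hb
    · exact absurd hs h.not_step_of_plug
  · rintro rfl
    exact Step.of_beta h

theorem DStep.split {m : ℕ} (V W : Val m) (M : Comp (m + 2)) :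
    DStep (.split (.pair V W) M) (M.inst₂ V W) :=
  DStep.of_beta (Beta.split V W M) (fun _ h => by cases h; rfl)

/-- Without injectivity of the labels, raw terms could have two branches for one injection. -/
theorem DStep.vcase {m k : ℕ} {l : Fin k → ℕ} (hl : Function.Injective l) (i : Fin k) (V : Val m)
    (M : Fin k → Comp (m + 1)) : DStep (.vcase (.inj (l i) V) k l M) ((M i).inst V) := by
  refine DStep.of_beta (Beta.vcase k l i V M) (fun X h => ?_)
  -- The application `l i` in an index would block the case analysis on `h`.
  generalize hU : Val.inj (l i) V = U at h
  cases h
  obtain ⟨e, rfl⟩ := Val.inj.inj hU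
  rw [hl e]

theorem DStep.force {m : ℕ} (M : Comp m) : DStep (.force (.thunk M)) M :=
  DStep.of_beta (Beta.force M) (fun _ h => by cases h; rfl)

theorem DStep.seq {m : ℕ} (V : Val m) (N : Comp (m + 1)) : DStep (.seq (.ret V) N) (N.inst V) :=
  DStep.of_beta (Beta.seq V N) (fun _ h => by cases h; rfl)

theorem DStep.app {m : ℕ} (M : Comp (m + 1)) (V : Val m) : DStep (.app (.lam M) V) (M.inst V) :=
  DStep.of_beta (Beta.app M V) (fun _ h => by cases h; rfl)

theorem DStep.prj {m : ℕ} (b : Bool) (M N : Comp m) :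
    DStep (.prj b (.cpair M N)) (cond b M N) :=
  DStep.of_beta (Beta.prj b M N) (fun _ h => by cases h; rfl)

theorem DStep.reify {m : ℕ} (Nu : Comp 1) (Nb : Comp 2) (V : Val m) :
    DStep (.reify (.mk Nu Nb) (.ret V)) (Nu.subst (push V Fin.elim0)) := by
  refine DStep.of_beta (Beta.reify Nu Nb V) (fun X h => ?_)
  generalize hP : Comp.ret V = P at h
  generalize hT : Comp.reify _ P = Q at h
  cases h <;> cases hT
  · cases hP; rfl
  · exact absurd hP.symm (plugHoist_reflect_ne_ret _ _ _)

/-- The continuation `{λ x. [H[return x]]^T}`. -/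
def contThunk {m : ℕ} (T : Mon) (H : List (BasicFrame m)) : Val m :=
  .thunk (.lam (.reify T (plugHoist (H.map (BasicFrame.rename Fin.succ)) (.ret (.var 0)))))

theorem DStep.reflect {m : ℕ} (Nu : Comp 1) (Nb : Comp 2) (H : List (BasicFrame m)) (N : Comp m) :
    DStep (Comp.reify (.mk Nu Nb) (LMon.plugHoist H (Comp.reflect N)))
      (Nb.subst (push (contThunk (.mk Nu Nb) H) (push (.thunk N) Fin.elim0))) := by
  refine DStep.of_beta (Beta.reflect Nu Nb H N) (fun X h => ?_)
  generalize hP : LMon.plugHoist H (Comp.reflect N) = P at h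
  generalize hT : Comp.reify _ P = Q at h
  cases h <;> cases hT
  · exact absurd hP (plugHoist_reflect_ne_ret _ _ _)
  · obtain ⟨rfl, rfl⟩ := plugHoist_reflect_inj hP
    rfl

/-- This is what makes the continuation passed to a bind body realize `k` as soon as `[H[return
V]]^T` realizes `k x`. -/
theorem contThunk_steps {m : ℕ} (T : Mon) (H : List (BasicFrame m)) (V : Val m) :
    DSteps (.app (.force (contThunk T H)) V) (.reify T (plugHoist H (.ret V))) := by
  have h := DStep.app
    (Comp.reify T (plugHoist (H.map (BasicFrame.rename Fin.succ)) (.ret (.var 0)))) V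
  rw [← plugHoist_rename_inst]
  exact (Relation.ReflTransGen.single ((DStep.force _).plug (.basic (.app V)))).tail h

theorem DSteps.eq_of_ret {m : ℕ} {M : Comp m} {V W : Val m} (h : DSteps M (.ret V))
    (h' : Steps M (.ret W)) : W = V := by
  induction h using Relation.ReflTransGen.head_induction_on with
  | refl =>
      cases h'.cases_head with
      | inl h => cases h; rfl
      | inr h => obtain ⟨_, h, -⟩ := h; exact absurd h not_step_ret
  | @head M N h _ ih =>
      cases h'.cases_head with
      | inl e => subst e; exact absurd ((h N).2 rfl) not_step_ret
      | inr e =>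
          obtain ⟨X, hX, hs⟩ := e
          rw [(h X).1 hX] at hs
          exact ih hs

theorem DSteps.steps {m : ℕ} {M N : Comp m} (h : DSteps M N) : Steps M N :=
  Relation.ReflTransGen.mono (fun _ _ h => (h _).2 rfl) _ _ h

theorem DSteps.steps_ret_iff {m : ℕ} {M : Comp m} {V : Val m} (h : DSteps M (.ret V))
    (W : Val m) : Steps M (.ret W) ↔ W = V :=
  ⟨h.eq_of_ret, fun e => e ▸ h.steps⟩

/-! ### Relations between closed terms and elements of sets -/

abbrev VRel (X : Type u) := Val 0 → X → Prop

abbrev CRel (X : Type u) := Comp 0 → X → Prop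

abbrev RelEnv {n : ℕ} (θ : Fin n → Type u) := ∀ i, VRel (θ i)

abbrev Lifting (T : Type u → Type u) := ∀ X : Type u, VRel X → CRel (T X)

/-- Zigzag-completeness (difunctionality) of a relation. -/
def Zigzag {α : Type} {X : Type u} (S : α → X → Prop) : Prop :=
  ∀ ⦃a b x y⦄, S a x → S b x → S b y → S a y

def pushRel {n : ℕ} {θ : Fin n → Type u} {X : Type u} (S : VRel X) (ρ : RelEnv θ) :
    RelEnv (push X θ) :=
  fun i => Fin.cases (motive := fun i => VRel (push X θ i)) S ρ i

def Mon.bindBody : Mon → Comp 2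
  | .mk _ Nb => Nb

/-- `Nb[{N}/y, {λ x. [H[return x]]^T}/f]`. -/
def Mon.bindInst (T : Mon) (N : Comp 0) (H : List (BasicFrame 0)) : Comp 0 :=
  T.bindBody.subst (push (contThunk T H) (push (.thunk N) Fin.elim0))

/-- The lifting for the monad `T` layered on top of an effect, where `R` interprets the type
constructor. The second component states that the reification of `M` in a hoisting context behaves
as the bind of `T` does. -/
def layerLift (T : Mon) {K : Type u → Type u} (R : ∀ X, VRel X → CRel (K X)) : Lifting K :=
  fun X S M t => R X S (.reify T M) t ∧
    ∀ N, R X S N t → ∀ (H : List (BasicFrame 0)) (Y : Type u) (S' : VRel Y), Zigzag S' →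
      ∀ k : X → K Y, (∀ V x, S V x → R Y S' (.reify T (plugHoist H (.ret V))) (k x)) →
        ∀ s, R Y S' (T.bindInst N H) s → R Y S' (.reify T (plugHoist H M)) s

mutual
-- Computation types are related through their eliminators: application, projections, and for
-- returners the lifting of the effect. The relation depends on raw syntax only, so it is shared by
-- all derivations of an effect.
def Eff.rel : {n : ℕ} → (E : Eff n) → (θ : Fin n → Type u) → RelEnv θ → (X : Type u) → VRel X →
    Comp 0 → E.T θ X → Prop
  | _, .pure, _, _, X, S, M, x => ∃ V, DSteps M (.ret V) ∧ S V (x : X)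
  | _, .layer E C T, θ, ρ, X, S, M, t =>
      layerLift T (K := fun X => C.car (push X θ) (E.T θ))
        (fun X S M t => C.rel (push X θ) (pushRel S ρ) (E.T θ) (E.rel θ ρ) M t) X S M t
def VTy.rel : {n : ℕ} → (A : VTy n) → (θ : Fin n → Type u) → RelEnv θ → Val 0 → A.car θ → Prop
  | _, .tvar i, _, ρ, V, a => ρ i V a
  | _, .unit, _, _, V, _ => V = .unit
  | _, .prod A B, θ, ρ, V, p => ∃ V₁ V₂, V = .pair V₁ V₂ ∧
      A.rel θ ρ V₁ (p : A.car θ × B.car θ).1 ∧ B.rel θ ρ V₂ (p : A.car θ × B.car θ).2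
  -- Raw variant types may repeat labels. Injectivity is built in so that a label determines the
  -- summand and `case` is deterministic.
  | _, .variant k l A, θ, ρ, V, p => Function.Injective l ∧
      ∃ W, V = .inj (l (p : Σ i : Fin k, (A i).car θ).1) W ∧
        (A (p : Σ i : Fin k, (A i).car θ).1).rel θ ρ W (p : Σ i : Fin k, (A i).car θ).2
  | _, .U E C, θ, ρ, V, t => C.rel θ ρ (E.T θ) (E.rel θ ρ) (.force V) t
def CTy.rel : {n : ℕ} → (C : CTy n) → (θ : Fin n → Type u) → RelEnv θ → (T : Type u → Type u) →
    Lifting T → Comp 0 → C.car θ T → Prop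
  | _, .F A, θ, ρ, _, L, M, t => L (A.car θ) (fun V a => A.rel θ ρ V a) M t
  | _, .fn A C, θ, ρ, T, L, M, f =>
      ∀ V a, A.rel θ ρ V a → C.rel θ ρ T L (.app M V) ((f : A.car θ → C.car θ T) a)
  | _, .prod C D, θ, ρ, T, L, M, p =>
      C.rel θ ρ T L (.prj true M) (p : C.car θ T × D.car θ T).1 ∧
        D.rel θ ρ T L (.prj false M) (p : C.car θ T × D.car θ T).2
end

/-! ### Closure properties -/

def Lifting.Expansive {T : Type u → Type u} (L : Lifting T) : Prop :=
  ∀ ⦃X S M M' t⦄, DStep M M' → L X S M' t → L X S M t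

def Lifting.Zigzag {T : Type u → Type u} (L : Lifting T) : Prop :=
  ∀ ⦃X S⦄, LMon.Zigzag S → LMon.Zigzag (L X S)

/-- Application and projection are frames, so deterministic steps pass through them down to the
returner case. -/
theorem CTy.rel_expand {T : Type u → Type u} {L : Lifting T} (hL : L.Expansive) :
    {n : ℕ} → (C : CTy n) → {θ : Fin n → Type u} → {ρ : RelEnv θ} → {M M' : Comp 0} →
    {t : C.car θ T} → DStep M M' → C.rel θ ρ T L M' t → C.rel θ ρ T L M t
  | _, .F _, _, _, _, _, _, h, ht => hL h ht
  | _, .fn _ C, _, _, _, _, _, h, ht => fun V a ha =>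
      C.rel_expand hL (h.plug (.basic (.app V))) (ht V a ha)
  | _, .prod C D, _, _, _, _, _, h, ht =>
      ⟨C.rel_expand hL (h.plug (.basic (.prj true))) ht.1,
        D.rel_expand hL (h.plug (.basic (.prj false))) ht.2⟩

theorem layerLift_expansive (T : Mon) {K : Type u → Type u} {R : ∀ X, VRel X → CRel (K X)}
    (hR : ∀ ⦃X S M M' t⦄, DStep M M' → R X S M' t → R X S M t) : (layerLift T R).Expansive :=
  fun _ _ _ _ _ h ht => ⟨hR (h.plug (.reify T)) ht.1, fun N hN H Y S' hS' k hk s hs =>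
    hR ((h.plugHoist H).plug (.reify T)) (ht.2 N hN H Y S' hS' k hk s hs)⟩

/-- The second component quantifies over the terms `N` related to the element. Zigzag-completeness
at the reified terms moves such an `N` from one element to the other, so the component known for the
first element applies. -/
theorem layerLift_zigzag (T : Mon) {K : Type u → Type u} {R : ∀ X, VRel X → CRel (K X)}
    (hR : ∀ ⦃X S⦄, Zigzag S → Zigzag (R X S)) : (layerLift T R).Zigzag :=
  fun _ _ hS _ _ _ _ h₁ h₂ h₃ => ⟨hR hS h₁.1 h₂.1 h₃.1, fun N hN =>
    h₁.2 N (hR hS hN h₃.1 h₂.1)⟩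

theorem Eff.rel_expansive : {n : ℕ} → (E : Eff n) → (θ : Fin n → Type u) → (ρ : RelEnv θ) →
    Lifting.Expansive (E.rel θ ρ)
  | _, .pure, _, _ => fun _ _ _ _ _ h ⟨V, hV, hx⟩ => ⟨V, hV.head h, hx⟩
  | _, .layer E C T, θ, ρ =>
      layerLift_expansive T (fun _ _ _ _ _ h ht => C.rel_expand (E.rel_expansive θ ρ) h ht)

theorem pushRel_zigzag {n : ℕ} {θ : Fin n → Type u} {ρ : RelEnv θ} (hρ : ∀ i, Zigzag (ρ i))
    {X : Type u} {S : VRel X} (hS : Zigzag S) : ∀ i, Zigzag (pushRel S ρ i) :=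
  fun i => Fin.cases hS hρ i

mutual
theorem Eff.rel_zigzag : {n : ℕ} → (E : Eff n) → {θ : Fin n → Type u} → {ρ : RelEnv θ} →
    (∀ i, Zigzag (ρ i)) → Lifting.Zigzag (E.rel θ ρ)
  -- The shared term evaluates to a single value, so the two relations known for it concern that
  -- same value.
  | _, .pure, _, _, _ => fun _ _ hS _ _ _ _ ⟨V, hV, hx⟩ ⟨_, hW, hy⟩ ⟨_, hW', hz⟩ =>
      ⟨V, hV, hS hx hy (hW.eq_of_ret hW'.steps ▸ hz)⟩
  | _, .layer E C T, _, _, hρ =>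
      layerLift_zigzag T (fun _ _ hS => C.rel_zigzag (pushRel_zigzag hρ hS) (E.rel_zigzag hρ))
theorem VTy.rel_zigzag : {n : ℕ} → (A : VTy n) → {θ : Fin n → Type u} → {ρ : RelEnv θ} →
    (∀ i, Zigzag (ρ i)) → Zigzag (A.rel θ ρ)
  | _, .tvar i, _, _, hρ => hρ i
  | _, .unit, _, _, _ => fun _ _ _ _ h _ _ => h
  | _, .prod A B, θ, ρ, hρ => by
      rintro _ _ x y ⟨V, W, rfl, hV, hW⟩ ⟨V', W', rfl, hV', hW'⟩ ⟨V'', W'', e, hV'', hW''⟩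
      cases e
      exact ⟨V, W, rfl, A.rel_zigzag hρ hV hV' hV'', B.rel_zigzag hρ hW hW' hW''⟩
  | _, .variant k l A, θ, ρ, hρ => by
      rintro _ _ ⟨i, x⟩ ⟨j, y⟩ ⟨hl, V, rfl, hV⟩ ⟨-, V', rfl, hV'⟩ ⟨-, V'', e, hV''⟩
      have hij := Val.inj.inj e
      obtain rfl : i = j := hl hij.1
      obtain rfl := hij.2
      exact ⟨hl, V, rfl, (A i).rel_zigzag hρ hV hV' hV''⟩
  | _, .U E C, θ, ρ, hρ => fun _ _ _ _ h₁ h₂ h₃ => C.rel_zigzag hρ (E.rel_zigzag hρ) h₁ h₂ h₃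
theorem CTy.rel_zigzag : {n : ℕ} → (C : CTy n) → {θ : Fin n → Type u} → {ρ : RelEnv θ} →
    {T : Type u → Type u} → {L : Lifting T} → (∀ i, Zigzag (ρ i)) → L.Zigzag →
    Zigzag (C.rel θ ρ T L)
  | _, .F A, _, _, _, _, hρ, hL => hL (A.rel_zigzag hρ)
  | _, .fn _ C, _, _, _, _, hρ, hL => fun _ _ _ _ h₁ h₂ h₃ V a ha =>
      C.rel_zigzag hρ hL (h₁ V a ha) (h₂ V a ha) (h₃ V a ha)
  | _, .prod C D, _, _, _, _, hρ, hL => fun _ _ _ _ h₁ h₂ h₃ =>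
      ⟨C.rel_zigzag hρ hL h₁.1 h₂.1 h₃.1, D.rel_zigzag hρ hL h₁.2 h₂.2 h₃.2⟩
end

/-! ### Renaming and substitution of type variables -/

/-- A set with a relation to the elements of `α`. -/
abbrev Sem (α : Type) := Σ X : Type u, α → X → Prop

abbrev SemEff := Σ T : Type u → Type u, Lifting T

-- Carriers and relations bundled, and transport along equalities

/-- The carriers of substituted types agree only propositionally, so relations on them can be
equated only together with their carriers. Equality of the bundles then yields the casts used in
denotations. -/
theorem Sem.rel_iff {α : Type} {p q : Sem.{u} α} (h : p = q) (hc : p.1 = q.1) (a : α) (x : p.1) :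
    p.2 a x ↔ q.2 a (cast hc x) := by
  subst h
  rfl

theorem Sem.rel_iff_symm {α : Type} {p q : Sem.{u} α} (h : p = q) (hc : q.1 = p.1) (a : α)
    (x : q.1) : p.2 a (cast hc x) ↔ q.2 a x := by
  subst h
  rfl

/-- An index must exist for the equality of the carriers to be extracted at all; in the application
the indices are relations on a fixed set. -/
theorem Sem.fun_ext {α : Type} {ι : Type u} [Nonempty ι] {K K' : Type u} {R : ι → α → K → Prop}
    {R' : ι → α → K' → Prop} (h : ∀ i, (⟨K, R i⟩ : Sem α) = ⟨K', R' i⟩) :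
    (⟨K, R⟩ : Σ K : Type u, ι → α → K → Prop) = ⟨K', R'⟩ := by
  obtain ⟨i⟩ := ‹Nonempty ι›
  obtain rfl : K = K' := congrArg Sigma.fst (h i)
  congr 1
  funext i
  exact eq_of_heq (Sigma.mk.inj (h i)).2

def Eff.sem {n : ℕ} (E : Eff n) (θ : Fin n → Type u) (ρ : RelEnv θ) : SemEff.{u} :=
  ⟨E.T θ, E.rel θ ρ⟩

def VTy.sem {n : ℕ} (A : VTy n) (θ : Fin n → Type u) (ρ : RelEnv θ) : Sem.{u} (Val 0) :=
  ⟨A.car θ, A.rel θ ρ⟩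

def CTy.sem {n : ℕ} (C : CTy n) (θ : Fin n → Type u) (ρ : RelEnv θ) (e : SemEff.{u}) :
    Sem.{u} (Comp 0) :=
  ⟨C.car θ e.1, C.rel θ ρ e.1 e.2⟩

def SemEff.layer (T : Mon) (g : ∀ X : Type u, Σ K : Type u, VRel X → CRel K) : SemEff.{u} :=
  ⟨fun X => (g X).1, layerLift T (fun X S => (g X).2 S)⟩

def Sem.prod (a b : Sem.{u} (Val 0)) : Sem.{u} (Val 0) :=
  ⟨a.1 × b.1, fun V p => ∃ V₁ V₂, V = .pair V₁ V₂ ∧ a.2 V₁ p.1 ∧ b.2 V₂ p.2⟩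

def Sem.variant {k : ℕ} (l : Fin k → ℕ) (a : Fin k → Sem.{u} (Val 0)) : Sem.{u} (Val 0) :=
  ⟨Σ i, (a i).1, fun V p =>
    Function.Injective l ∧ ∃ W, V = .inj (l p.1) W ∧ (a p.1).2 W p.2⟩

def Sem.thunk (c : Sem.{u} (Comp 0)) : Sem.{u} (Val 0) := ⟨c.1, fun V t => c.2 (.force V) t⟩

def Sem.free (e : SemEff.{u}) (a : Sem.{u} (Val 0)) : Sem.{u} (Comp 0) := ⟨e.1 a.1, e.2 a.1 a.2⟩

def Sem.fn (a : Sem.{u} (Val 0)) (c : Sem.{u} (Comp 0)) : Sem.{u} (Comp 0) :=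
  ⟨a.1 → c.1, fun M f => ∀ V x, a.2 V x → c.2 (.app M V) (f x)⟩

def Sem.cprod (c d : Sem.{u} (Comp 0)) : Sem.{u} (Comp 0) :=
  ⟨c.1 × d.1, fun M p => c.2 (.prj true M) p.1 ∧ d.2 (.prj false M) p.2⟩

theorem Eff.sem_layer {n : ℕ} (E : Eff n) (C : CTy (n + 1)) (T : Mon) (θ : Fin n → Type u)
    (ρ : RelEnv θ) : (Eff.layer E C T).sem θ ρ = SemEff.layer T (fun X =>
      ⟨C.car (push X θ) (E.T θ), fun S => C.rel (push X θ) (pushRel S ρ) (E.T θ) (E.rel θ ρ)⟩) :=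
  rfl

theorem VTy.sem_prod {n : ℕ} (A B : VTy n) (θ : Fin n → Type u) (ρ : RelEnv θ) :
    (VTy.prod A B).sem θ ρ = (A.sem θ ρ).prod (B.sem θ ρ) := rfl

theorem VTy.sem_variant {n k : ℕ} (l : Fin k → ℕ) (A : Fin k → VTy n) (θ : Fin n → Type u)
    (ρ : RelEnv θ) : (VTy.variant k l A).sem θ ρ = Sem.variant l (fun i => (A i).sem θ ρ) := rfl

theorem VTy.sem_U {n : ℕ} (E : Eff n) (C : CTy n) (θ : Fin n → Type u) (ρ : RelEnv θ) :
    (VTy.U E C).sem θ ρ = (C.sem θ ρ (E.sem θ ρ)).thunk := rfl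

theorem CTy.sem_F {n : ℕ} (A : VTy n) (θ : Fin n → Type u) (ρ : RelEnv θ) (e : SemEff.{u}) :
    (CTy.F A).sem θ ρ e = Sem.free e (A.sem θ ρ) := rfl

theorem CTy.sem_fn {n : ℕ} (A : VTy n) (C : CTy n) (θ : Fin n → Type u) (ρ : RelEnv θ)
    (e : SemEff.{u}) : (CTy.fn A C).sem θ ρ e = (A.sem θ ρ).fn (C.sem θ ρ e) := rfl

theorem CTy.sem_prod {n : ℕ} (C D : CTy n) (θ : Fin n → Type u) (ρ : RelEnv θ)
    (e : SemEff.{u}) : (CTy.prod C D).sem θ ρ e = (C.sem θ ρ e).cprod (D.sem θ ρ e) := rfl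

theorem CTy.sem_congr {n : ℕ} (C : CTy n) {θ θ' : Fin n → Type u} {ρ : RelEnv θ} {ρ' : RelEnv θ'}
    (h : ∀ i, (⟨θ i, ρ i⟩ : Sem.{u} (Val 0)) = ⟨θ' i, ρ' i⟩) (e : SemEff.{u}) :
    C.sem θ ρ e = C.sem θ' ρ' e :=
  congrArg (fun η : Fin n → Sem.{u} (Val 0) => C.sem (fun i => (η i).1) (fun i => (η i).2) e)
    (funext h)

/-- A layer depends on its constituents only through the interpretation of `α. C` at all sets and
relations. -/
theorem Eff.sem_layer_congr {n n' : ℕ} {E : Eff n} {E' : Eff n'} {C : CTy (n + 1)}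
    {C' : CTy (n' + 1)} (T : Mon) {θ : Fin n → Type u} {ρ : RelEnv θ} {θ' : Fin n' → Type u}
    {ρ' : RelEnv θ'}
    (h : ∀ X (S : VRel X), C.sem (push X θ) (pushRel S ρ) (E.sem θ ρ) =
      C'.sem (push X θ') (pushRel S ρ') (E'.sem θ' ρ')) :
    (Eff.layer E C T).sem θ ρ = (Eff.layer E' C' T).sem θ' ρ' := by
  rw [Eff.sem_layer, Eff.sem_layer]
  congr 1
  funext X
  exact Sem.fun_ext (h X)

mutual
theorem Eff.sem_rename : {n : ℕ} → (E : Eff n) → {n' : ℕ} → (r : Fin n → Fin n') →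
    (θ : Fin n' → Type u) → (ρ : RelEnv θ) →
    (E.rename r).sem θ ρ = E.sem (fun i => θ (r i)) (fun i => ρ (r i))
  | _, .pure, _, _, _, _ => by rw [Eff.rename]; rfl
  | _, .layer E C T, _, r, θ, ρ => by
      rw [Eff.rename]
      refine Eff.sem_layer_congr T (fun X S => ?_)
      rw [CTy.sem_rename C, Eff.sem_rename E]
      exact C.sem_congr (fun i => by refine Fin.cases rfl (fun _ => rfl) i) _
theorem VTy.sem_rename : {n : ℕ} → (A : VTy n) → {n' : ℕ} → (r : Fin n → Fin n') →
    (θ : Fin n' → Type u) → (ρ : RelEnv θ) →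
    (A.rename r).sem θ ρ = A.sem (fun i => θ (r i)) (fun i => ρ (r i))
  | _, .tvar _, _, _, _, _ => by rw [VTy.rename]; rfl
  | _, .unit, _, _, _, _ => by rw [VTy.rename]; rfl
  | _, .prod A B, _, r, θ, ρ => by
      rw [VTy.rename, VTy.sem_prod, VTy.sem_rename A, VTy.sem_rename B]; rfl
  | _, .variant k l A, _, r, θ, ρ => by
      rw [VTy.rename, VTy.sem_variant, funext (fun i => VTy.sem_rename (A i) r θ ρ)]; rfl
  | _, .U E C, _, r, θ, ρ => by
      rw [VTy.rename, VTy.sem_U, CTy.sem_rename C, Eff.sem_rename E]; rfl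
theorem CTy.sem_rename : {n : ℕ} → (C : CTy n) → {n' : ℕ} → (r : Fin n → Fin n') →
    (θ : Fin n' → Type u) → (ρ : RelEnv θ) → (e : SemEff.{u}) →
    (C.rename r).sem θ ρ e = C.sem (fun i => θ (r i)) (fun i => ρ (r i)) e
  | _, .F A, _, r, θ, ρ, e => by
      rw [CTy.rename, CTy.sem_F, VTy.sem_rename A]; rfl
  | _, .fn A C, _, r, θ, ρ, e => by
      rw [CTy.rename, CTy.sem_fn, VTy.sem_rename A, CTy.sem_rename C]; rfl
  | _, .prod C D, _, r, θ, ρ, e => by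
      rw [CTy.rename, CTy.sem_prod, CTy.sem_rename C, CTy.sem_rename D]; rfl
end

mutual
theorem Eff.sem_subst : {n : ℕ} → (E : Eff n) → {n' : ℕ} → (s : Fin n → VTy n') →
    (θ : Fin n' → Type u) → (ρ : RelEnv θ) →
    (E.subst s).sem θ ρ = E.sem (fun i => (s i).car θ) (fun i => (s i).rel θ ρ)
  | _, .pure, _, _, _, _ => by rw [Eff.subst]; rfl
  | _, .layer E C T, _, s, θ, ρ => by
      rw [Eff.subst]
      refine Eff.sem_layer_congr T (fun X S => ?_)
      rw [CTy.sem_subst C, Eff.sem_subst E]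
      exact C.sem_congr (fun i => by
        refine Fin.cases rfl (fun j => ?_) i
        exact VTy.sem_rename (s j) Fin.succ (push X θ) (pushRel S ρ)) _
theorem VTy.sem_subst : {n : ℕ} → (A : VTy n) → {n' : ℕ} → (s : Fin n → VTy n') →
    (θ : Fin n' → Type u) → (ρ : RelEnv θ) →
    (A.subst s).sem θ ρ = A.sem (fun i => (s i).car θ) (fun i => (s i).rel θ ρ)
  | _, .tvar _, _, _, _, _ => by rw [VTy.subst]; rfl
  | _, .unit, _, _, _, _ => by rw [VTy.subst]; rfl
  | _, .prod A B, _, s, θ, ρ => by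
      rw [VTy.subst, VTy.sem_prod, VTy.sem_subst A, VTy.sem_subst B]; rfl
  | _, .variant k l A, _, s, θ, ρ => by
      rw [VTy.subst, VTy.sem_variant, funext (fun i => VTy.sem_subst (A i) s θ ρ)]; rfl
  | _, .U E C, _, s, θ, ρ => by
      rw [VTy.subst, VTy.sem_U, CTy.sem_subst C, Eff.sem_subst E]; rfl
theorem CTy.sem_subst : {n : ℕ} → (C : CTy n) → {n' : ℕ} → (s : Fin n → VTy n') →
    (θ : Fin n' → Type u) → (ρ : RelEnv θ) → (e : SemEff.{u}) →
    (C.subst s).sem θ ρ e = C.sem (fun i => (s i).car θ) (fun i => (s i).rel θ ρ) e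
  | _, .F A, _, s, θ, ρ, e => by
      rw [CTy.subst, CTy.sem_F, VTy.sem_subst A]; rfl
  | _, .fn A C, _, s, θ, ρ, e => by
      rw [CTy.subst, CTy.sem_fn, VTy.sem_subst A, CTy.sem_subst C]; rfl
  | _, .prod C D, _, s, θ, ρ, e => by
      rw [CTy.subst, CTy.sem_prod, CTy.sem_subst C, CTy.sem_subst D]; rfl
end

theorem Eff.sem_wk {n : ℕ} (E : Eff n) {θ : Fin n → Type u} (ρ : RelEnv θ) {X : Type u}
    (S : VRel X) : E.wk.sem (push X θ) (pushRel S ρ) = E.sem θ ρ :=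
  Eff.sem_rename E Fin.succ (push X θ) (pushRel S ρ)

theorem CTy.sem_at₁ {n : ℕ} (C : CTy (n + 1)) {θ : Fin n → Type u} (ρ : RelEnv θ) {X Y : Type u}
    (S : VRel X) (S' : VRel Y) (e : SemEff.{u}) :
    C.at₁.sem (push Y (push X θ)) (pushRel S' (pushRel S ρ)) e =
      C.sem (push X θ) (pushRel S ρ) e := by
  rw [CTy.at₁, CTy.sem_rename]
  exact C.sem_congr (fun i => by refine Fin.cases rfl (fun _ => rfl) i) e

theorem CTy.sem_at₂ {n : ℕ} (C : CTy (n + 1)) {θ : Fin n → Type u} (ρ : RelEnv θ) {X Y : Type u}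
    (S : VRel X) (S' : VRel Y) (e : SemEff.{u}) :
    C.at₂.sem (push Y (push X θ)) (pushRel S' (pushRel S ρ)) e =
      C.sem (push Y θ) (pushRel S' ρ) e := by
  rw [CTy.at₂, CTy.sem_rename]
  exact C.sem_congr (fun i => by refine Fin.cases rfl (fun _ => rfl) i) e

theorem CTy.sem_inst {n : ℕ} (C : CTy (n + 1)) (A : VTy n) {θ : Fin n → Type u} (ρ : RelEnv θ)
    (e : SemEff.{u}) :
    (C.inst A).sem θ ρ e = C.sem (push (A.car θ) θ) (pushRel (A.rel θ ρ) ρ) e := by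
  rw [CTy.inst, CTy.sem_subst]
  exact C.sem_congr (fun i => by refine Fin.cases rfl (fun _ => rfl) i) e

/-! ### Monads compatible with liftings -/

theorem rel_of_dsteps {X : Type u} {R : CRel X} {t : X}
    (hR : ∀ ⦃M M'⦄, DStep M M' → R M' t → R M t) {M M' : Comp 0} (h : DSteps M M')
    (ht : R M' t) : R M t := by
  induction h using Relation.ReflTransGen.head_induction_on with
  | refl => exact ht
  | head h _ ih => exact hR h ih

/-- A monad whose return and bind are realized by returning and sequencing. -/
structure Adequate {T : Type u → Type u} (L : Lifting T) (μ : RetBind T) : Prop where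
  isMonad : μ.IsMonad
  ret : ∀ {X : Type u} {S : VRel X}, Zigzag S → ∀ {V x}, S V x → L X S (.ret V) (μ.ret x)
  bind : ∀ {X Y : Type u} {S : VRel X} {S' : VRel Y}, Zigzag S → Zigzag S' →
    ∀ {H : List (BasicFrame 0)} {M : Comp 0} {t : T X} {f : X → T Y}, L X S M t →
    (∀ V x, S V x → L Y S' (plugHoist H (.ret V)) (f x)) →
    L Y S' (plugHoist H M) (μ.bind t f)

/-- A monad whose return and bind are realized by the bodies of `T`. -/
structure MonModel (T : Mon) {K : Type u → Type u} (R : ∀ X, VRel X → CRel (K X))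
    (μ : RetBind K) : Prop where
  expand : ∀ ⦃X S M M' t⦄, DStep M M' → R X S M' t → R X S M t
  zigzag : ∀ ⦃X S⦄, Zigzag S → Zigzag (R X S)
  isMonad : μ.IsMonad
  reify_ret : ∀ {X : Type u} {S : VRel X}, Zigzag S → ∀ {V x}, S V x →
    R X S (.reify T (.ret V)) (μ.ret x)
  reify_reflect : ∀ {X : Type u} {S : VRel X} (H : List (BasicFrame 0)) (N : Comp 0) {t},
    R X S (T.bindInst N H) t → R X S (.reify T (plugHoist H (.reflect N))) t
  bind : ∀ {X Y : Type u} {S : VRel X} {S' : VRel Y}, Zigzag S → Zigzag S' →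
    ∀ {H : List (BasicFrame 0)} {N : Comp 0} {t : K X} {k : X → K Y}, R X S N t →
    (∀ V x, S V x → R Y S' (.reify T (plugHoist H (.ret V))) (k x)) →
    R Y S' (T.bindInst N H) (μ.bind t k)

theorem plugHoist_append {m : ℕ} (H H' : List (BasicFrame m)) (M : Comp m) :
    plugHoist (H ++ H') M = plugHoist H (plugHoist H' M) := by
  simp only [plugHoist, List.foldr_append]

/-- The second component of `layerLift` is used with `N := [M]^T`, which the first component relates
to `t`. -/
theorem MonModel.reify_plug {T : Mon} {K : Type u → Type u} {R : ∀ X, VRel X → CRel (K X)}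
    {μ : RetBind K} (h : MonModel T R μ) {X Y : Type u} {S : VRel X} {S' : VRel Y} (hS : Zigzag S)
    (hS' : Zigzag S') {H : List (BasicFrame 0)} {M : Comp 0} {t : K X} {k : X → K Y}
    (ht : layerLift T R X S M t)
    (hk : ∀ V x, S V x → R Y S' (.reify T (plugHoist H (.ret V))) (k x)) :
    R Y S' (.reify T (plugHoist H M)) (μ.bind t k) :=
  ht.2 _ ht.1 H Y S' hS' k hk _ (h.bind hS hS' ht.1 hk)

/-- The introduction rule for `layerLift`, now phrased with the denotational bind. The term
`[H[M]]^T` and the instantiated bind body are both related to `bind t k`; zigzag-completeness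
transfers every other element of the latter to the former. -/
theorem MonModel.layerLift_of_bind {T : Mon} {K : Type u → Type u}
    {R : ∀ X, VRel X → CRel (K X)} {μ : RetBind K} (h : MonModel T R μ) {X : Type u} {S : VRel X}
    (hS : Zigzag S) {M : Comp 0} {t : K X} (ht : R X S (.reify T M) t)
    (hM : ∀ (H : List (BasicFrame 0)) (Y : Type u) (S' : VRel Y), Zigzag S' → ∀ k : X → K Y,
      (∀ V x, S V x → R Y S' (.reify T (plugHoist H (.ret V))) (k x)) →
      R Y S' (.reify T (plugHoist H M)) (μ.bind t k)) : layerLift T R X S M t :=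
  ⟨ht, fun _ hN H Y S' hS' k hk _ hs =>
    h.zigzag hS' (hM H Y S' hS' k hk) (h.bind hS hS' hN hk) hs⟩

/-- The left unit law turns `bind (ret x) k` into `k x`. For sequencing, associativity of bind
mirrors the concatenation of the stacks `H'` and `H`. -/
theorem MonModel.adequate {T : Mon} {K : Type u → Type u} {R : ∀ X, VRel X → CRel (K X)}
    {μ : RetBind K} (h : MonModel T R μ) : Adequate (layerLift T R) μ where
  isMonad := h.isMonad
  ret hS V x hx := h.layerLift_of_bind hS (h.reify_ret hS hx) (fun H Y S' hS' k hk => by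
    rw [h.isMonad.ret_bind]
    exact hk V x hx)
  bind {X Y S S'} hS hS' {H M t f} ht hf := by
    refine h.layerLift_of_bind hS' (h.reify_plug hS hS' ht (fun V x hx => (hf V x hx).1))
      (fun H' Z S'' hS'' k hk => ?_)
    rw [h.isMonad.bind_bind, ← plugHoist_append]
    refine h.reify_plug hS hS'' ht (fun V x hx => ?_)
    rw [plugHoist_append]
    exact h.reify_plug hS' hS'' (hf V x hx) hk

/-- In any stack, `[H[μ(N)]]^T` reduces to the bind body applied to `N`. -/
theorem MonModel.reflect {T : Mon} {K : Type u → Type u} {R : ∀ X, VRel X → CRel (K X)}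
    {μ : RetBind K} (h : MonModel T R μ) {X : Type u} {S : VRel X} (hS : Zigzag S) {N : Comp 0}
    {t : K X} (ht : R X S N t) : layerLift T R X S (.reflect N) t := by
  refine h.layerLift_of_bind hS ?_ (fun H Y S' hS' k hk =>
    h.reify_reflect H N (h.bind hS hS' ht hk))
  -- With the empty stack the continuation is `[return x]^T`, which realizes the return; the right
  -- unit law recovers `t`.
  rw [← h.isMonad.bind_ret t]
  exact h.reify_reflect [] N (h.bind hS hS ht (fun V x hx => h.reify_ret hS hx))

theorem pure_adequate (n : ℕ) (θ : Fin n → Type u) (ρ : RelEnv θ) :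
    Adequate (T := (Eff.pure : Eff n).T θ) (Eff.rel .pure θ ρ) (KEff.pure.mon θ) where
  isMonad := ⟨fun _ _ => rfl, fun _ => rfl, fun _ _ _ => rfl⟩
  ret _ V _ hx := ⟨V, Relation.ReflTransGen.refl, hx⟩
  bind := by
    rintro X Y S S' - - H M t f ⟨V, hV, ht⟩ hf
    obtain ⟨W, hW, h⟩ := hf V t ht
    exact ⟨W, (hV.plugHoist H).trans hW, h⟩

-- Kleisli extension into algebras

theorem RetBind.IsMonad.bind_fmap {T : Type u → Type u} {μ : RetBind T} (h : μ.IsMonad)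
    {X Y Z : Type u} (f : X → Y) (t : T X) (g : Y → T Z) :
    μ.bind (μ.fmap f t) g = μ.bind t (fun x => g (f x)) := by
  rw [RetBind.fmap, h.bind_bind]
  simp only [h.ret_bind]

theorem RetBind.IsMonad.fmap_fmap {T : Type u → Type u} {μ : RetBind T} (h : μ.IsMonad)
    {X Y Z : Type u} (f : X → Y) (t : T X) (g : Y → Z) :
    μ.fmap g (μ.fmap f t) = μ.fmap (fun x => g (f x)) t :=
  h.bind_fmap f t _

/-- Algebras at function and product types are pointwise and componentwise, so applying or
projecting the extension gives an extension at a smaller type. On terms the corresponding frame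
joins `H`, hence the generality in `H`; at returners the extension is the bind. -/
theorem CTy.rel_kext {T : Type u → Type u} {L : Lifting T} {μ : RetBind T} (hL : Adequate L μ)
    {X : Type u} {S : VRel X} (hS : Zigzag S) {M : Comp 0} {t : T X} (ht : L X S M t) :
    {n : ℕ} → (C : CTy n) → {θ : Fin n → Type u} → {ρ : RelEnv θ} → (∀ i, Zigzag (ρ i)) →
    {H : List (BasicFrame 0)} → {f : X → C.car θ T} →
    (∀ V x, S V x → C.rel θ ρ T L (plugHoist H (.ret V)) (f x)) →
    C.rel θ ρ T L (plugHoist H M) (C.kext μ θ t f)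
  | _, .F A, θ, ρ, hρ, H, f, hf => by
      have e : (CTy.F A).kext μ θ t f = μ.bind t f := hL.isMonad.bind_fmap f t (fun y => y)
      rw [e]
      exact hL.bind hS (A.rel_zigzag hρ) ht hf
  | _, .fn A C, θ, ρ, hρ, H, f, hf => fun V a ha => by
      have e : ((CTy.fn A C).kext μ θ t f : A.car θ → C.car θ T) a =
          C.kext μ θ t (fun x => (f x : A.car θ → C.car θ T) a) := 
        congrArg (C.alg μ θ) (hL.isMonad.fmap_fmap f t _)
      rw [e]
      exact C.rel_kext hL hS ht hρ (H := .app V :: H) (fun W x hx => hf W x hx V a ha)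
  | _, .prod C D, θ, ρ, hρ, H, f, hf => by
      have e₁ : ((CTy.prod C D).kext μ θ t f : C.car θ T × D.car θ T).1 =
          C.kext μ θ t (fun x => (f x : C.car θ T × D.car θ T).1) := 
        congrArg (C.alg μ θ) (hL.isMonad.fmap_fmap f t _)
      have e₂ : ((CTy.prod C D).kext μ θ t f : C.car θ T × D.car θ T).2 =
          D.kext μ θ t (fun x => (f x : C.car θ T × D.car θ T).2) := 
        congrArg (D.alg μ θ) (hL.isMonad.fmap_fmap f t _)
      refine ⟨?_, ?_⟩
      · rw [e₁]
        exact C.rel_kext hL hS ht hρ (H := .prj true :: H) (fun W x hx => (hf W x hx).1)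
      · rw [e₂]
        exact D.rel_kext hL hS ht hρ (H := .prj false :: H) (fun W x hx => (hf W x hx).2)

/-- The monads on `T_E` that the raw effect `E` may denote. -/
def Eff.Model : {n : ℕ} → (E : Eff n) → (θ : Fin n → Type u) → RelEnv θ → RetBind (E.T θ) → Prop
  | _, .pure, θ, ρ, μ => Adequate (T := (Eff.pure).T θ) (Eff.rel .pure θ ρ) μ
  | _, .layer E C T, θ, ρ, μ =>
      MonModel T (K := fun X => C.car (push X θ) (E.T θ))
        (fun X S M t => C.rel (push X θ) (pushRel S ρ) (E.T θ) (E.rel θ ρ) M t)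
        ⟨fun x => μ.ret x, fun t f => μ.bind t f⟩

theorem Eff.Model.adequate : {n : ℕ} → {E : Eff n} → {θ : Fin n → Type u} → {ρ : RelEnv θ} →
    {μ : RetBind (E.T θ)} → E.Model θ ρ μ → Adequate (T := E.T θ) (E.rel θ ρ) μ
  | _, .pure, _, _, _, h => h
  | _, .layer _ _ _, _, _, _, h => MonModel.adequate h

/-! ### Semantic typing -/

/-- `V` realizes the function `d` at the type assignment `θ`. -/
def ValRel {n m : ℕ} (Γ : Fin m → VTy n) (θ : Fin n → Type u) (V : Val m) (A : VTy n)
    (d : Env Γ θ → A.car θ) : Prop :=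
  ∀ ρ : RelEnv θ, (∀ i, Zigzag (ρ i)) → ∀ (s : Fin m → Val 0) (γ : Env Γ θ),
    (∀ i, (Γ i).rel θ ρ (s i) (γ i)) → A.rel θ ρ (V.subst s) (d γ)

/-- `M` realizes the function `d` at the type assignment `θ`. -/
def CompRel {n m : ℕ} (Γ : Fin m → VTy n) (θ : Fin n → Type u) (E : Eff n) (M : Comp m)
    (C : CTy n) (d : Env Γ θ → C.car θ (E.T θ)) : Prop :=
  ∀ ρ : RelEnv θ, (∀ i, Zigzag (ρ i)) → ∀ (s : Fin m → Val 0) (γ : Env Γ θ),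
    (∀ i, (Γ i).rel θ ρ (s i) (γ i)) → C.rel θ ρ (E.T θ) (E.rel θ ρ) (M.subst s) (d γ)

-- Compatibility of realizability with the typing rules

section rules

variable {n m : ℕ} {Γ : Fin m → VTy n} {θ : Fin n → Type u} {E : Eff n}

theorem rel_push {ρ : RelEnv θ} {s : Fin m → Val 0} {γ : Env Γ θ}
    (h : ∀ i, (Γ i).rel θ ρ (s i) (γ i)) {A : VTy n} {V : Val 0} {a : A.car θ}
    (ha : A.rel θ ρ V a) : ∀ i, (push A Γ i).rel θ ρ (push V s i) (Env.push a γ i) :=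
  fun i => Fin.cases (motive := fun i => (push A Γ i).rel θ ρ (push V s i) (Env.push a γ i)) ha h i

theorem ValRel.var (i : Fin m) : ValRel Γ θ (.var i) (Γ i) (fun γ => γ i) :=
  fun _ _ s _ h => by simpa only [Val.subst] using h i

theorem ValRel.unit : ValRel Γ θ .unit .unit (fun _ => PUnit.unit) :=
  fun _ _ s _ h => by
    simp only [Val.subst]
    rfl

theorem ValRel.pair {V W : Val m} {A B : VTy n} {d : Env Γ θ → A.car θ} {e : Env Γ θ → B.car θ}
    (hV : ValRel Γ θ V A d) (hW : ValRel Γ θ W B e) :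
    ValRel Γ θ (.pair V W) (.prod A B) (fun γ => (d γ, e γ)) :=
  fun ρ hρ s γ h => by
    simp only [Val.subst]
    exact ⟨_, _, rfl, hV ρ hρ s γ h, hW ρ hρ s γ h⟩

theorem ValRel.inj {V : Val m} {k : ℕ} {l : Fin k → ℕ} {A : Fin k → VTy n}
    (hl : Function.Injective l) (i : Fin k) {d : Env Γ θ → (A i).car θ}
    (hV : ValRel Γ θ V (A i) d) :
    ValRel Γ θ (.inj (l i) V) (.variant k l A) (fun γ => (⟨i, d γ⟩ : Σ i, (A i).car θ)) :=
  fun ρ hρ s γ h => by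
    simp only [Val.subst]
    exact ⟨hl, _, rfl, hV ρ hρ s γ h⟩

theorem CompRel.expand {M M' : Comp 0} {C : CTy n} {ρ : RelEnv θ} {t : C.car θ (E.T θ)}
    (h : DStep M M') (ht : C.rel θ ρ (E.T θ) (E.rel θ ρ) M' t) :
    C.rel θ ρ (E.T θ) (E.rel θ ρ) M t :=
  C.rel_expand (E.rel_expansive θ ρ) h ht

theorem ValRel.thunk {M : Comp m} {C : CTy n} {d : Env Γ θ → C.car θ (E.T θ)}
    (hM : CompRel Γ θ E M C d) : ValRel Γ θ (.thunk M) (.U E C) d :=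
  fun ρ hρ s γ h => by
    simp only [Val.subst]
    exact CompRel.expand (DStep.force _) (hM ρ hρ s γ h)

theorem CompRel.split {V : Val m} {M : Comp (m + 2)} {A B : VTy n} {C : CTy n}
    {d : Env Γ θ → A.car θ × B.car θ}
    {e : Env (push B (push A Γ)) θ → C.car θ (E.T θ)} (hV : ValRel Γ θ V (.prod A B) d)
    (hM : CompRel (push B (push A Γ)) θ E M C e) :
    CompRel Γ θ E (.split V M) C (fun γ => e (Env.push (d γ).2 (Env.push (d γ).1 γ))) :=
  fun ρ hρ s γ h => by
    simp only [Comp.subst]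
    obtain ⟨V₁, V₂, e, h₁, h₂⟩ := hV ρ hρ s γ h
    rw [e]
    refine CompRel.expand (DStep.split _ _ _) ?_
    rw [Comp.inst₂_subst_liftS]
    exact hM ρ hρ _ _ (rel_push (rel_push h h₁) h₂)

theorem CompRel.vcase {V : Val m} {k : ℕ} {l : Fin k → ℕ} {M : Fin k → Comp (m + 1)}
    {A : Fin k → VTy n} {C : CTy n} {d : Env Γ θ → Σ i, (A i).car θ}
    {e : ∀ i, Env (push (A i) Γ) θ → C.car θ (E.T θ)}
    (hV : ValRel Γ θ V (.variant k l A) d)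
    (hM : ∀ i, CompRel (push (A i) Γ) θ E (M i) C (e i)) :
    CompRel Γ θ E (.vcase V k l M) C (fun γ => e (d γ).1 (Env.push (d γ).2 γ)) :=
  fun ρ hρ s γ h => by
    simp only [Comp.subst]
    obtain ⟨hl, W, e, hW⟩ := hV ρ hρ s γ h
    rw [e]
    refine CompRel.expand (DStep.vcase hl _ _ _) ?_
    rw [Comp.inst_subst_liftS]
    exact hM _ ρ hρ _ _ (rel_push h hW)

theorem CompRel.force {V : Val m} {C : CTy n} {d : Env Γ θ → C.car θ (E.T θ)}
    (hV : ValRel Γ θ V (.U E C) d) : CompRel Γ θ E (.force V) C d :=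
  fun ρ hρ s γ h => by
    simp only [Comp.subst]
    exact hV ρ hρ s γ h

theorem CompRel.ret {μ : RetBind (E.T θ)}
    (hE : ∀ ρ : RelEnv θ, (∀ i, Zigzag (ρ i)) → E.Model θ ρ μ) {V : Val m} {A : VTy n}
    {d : Env Γ θ → A.car θ} (hV : ValRel Γ θ V A d) :
    CompRel Γ θ E (.ret V) (.F A) (fun γ => μ.ret (d γ)) :=
  fun ρ hρ s γ h => by
    simp only [Comp.subst]
    exact (hE ρ hρ).adequate.ret (A.rel_zigzag hρ) (hV ρ hρ s γ h)

theorem CompRel.seq {μ : RetBind (E.T θ)}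
    (hE : ∀ ρ : RelEnv θ, (∀ i, Zigzag (ρ i)) → E.Model θ ρ μ) {M : Comp m} {N : Comp (m + 1)}
    {A : VTy n} {C : CTy n} {d : Env Γ θ → E.T θ (A.car θ)}
    {e : Env (push A Γ) θ → C.car θ (E.T θ)} (hM : CompRel Γ θ E M (.F A) d)
    (hN : CompRel (push A Γ) θ E N C e) :
    CompRel Γ θ E (.seq M N) C (fun γ => C.kext μ θ (d γ) (fun a => e (Env.push a γ))) :=
  fun ρ hρ s γ h => by
    simp only [Comp.subst]
    refine C.rel_kext (hE ρ hρ).adequate (A.rel_zigzag hρ) (hM ρ hρ s γ h) hρ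
      (H := [.seq (N.subst (liftS s))]) (fun V x hx => ?_)
    refine CompRel.expand (DStep.seq _ _) ?_
    rw [Comp.inst_subst_liftS]
    exact hN ρ hρ _ _ (rel_push h hx)

theorem CompRel.lam {M : Comp (m + 1)} {A : VTy n} {C : CTy n}
    {d : Env (push A Γ) θ → C.car θ (E.T θ)} (hM : CompRel (push A Γ) θ E M C d) :
    CompRel Γ θ E (.lam M) (.fn A C) (fun γ (a : A.car θ) => d (Env.push a γ)) :=
  fun ρ hρ s γ h => by
    simp only [Comp.subst]
    intro V a ha
    refine CompRel.expand (DStep.app _ _) ?_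
    rw [Comp.inst_subst_liftS]
    exact hM ρ hρ _ _ (rel_push h ha)

theorem CompRel.app {M : Comp m} {V : Val m} {A : VTy n} {C : CTy n}
    {d : Env Γ θ → A.car θ → C.car θ (E.T θ)} {e : Env Γ θ → A.car θ}
    (hM : CompRel Γ θ E M (.fn A C) d) (hV : ValRel Γ θ V A e) :
    CompRel Γ θ E (.app M V) C (fun γ => d γ (e γ)) :=
  fun ρ hρ s γ h => by
    simp only [Comp.subst]
    exact hM ρ hρ s γ h _ _ (hV ρ hρ s γ h)

theorem CompRel.cpair {M N : Comp m} {C D : CTy n} {d : Env Γ θ → C.car θ (E.T θ)}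
    {e : Env Γ θ → D.car θ (E.T θ)} (hM : CompRel Γ θ E M C d) (hN : CompRel Γ θ E N D e) :
    CompRel Γ θ E (.cpair M N) (.prod C D) (fun γ => (d γ, e γ)) :=
  fun ρ hρ s γ h => by
    simp only [Comp.subst]
    exact ⟨CompRel.expand (DStep.prj true _ _) (hM ρ hρ s γ h),
      CompRel.expand (DStep.prj false _ _) (hN ρ hρ s γ h)⟩

theorem CompRel.fst {M : Comp m} {C D : CTy n}
    {d : Env Γ θ → C.car θ (E.T θ) × D.car θ (E.T θ)} (hM : CompRel Γ θ E M (.prod C D) d) :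
    CompRel Γ θ E (.prj true M) C (fun γ => (d γ).1) :=
  fun ρ hρ s γ h => by
    simp only [Comp.subst]
    exact (hM ρ hρ s γ h).1

theorem CompRel.snd {M : Comp m} {C D : CTy n}
    {d : Env Γ θ → C.car θ (E.T θ) × D.car θ (E.T θ)} (hM : CompRel Γ θ E M (.prod C D) d) :
    CompRel Γ θ E (.prj false M) D (fun γ => (d γ).2) :=
  fun ρ hρ s γ h => by
    simp only [Comp.subst]
    exact (hM ρ hρ s γ h).2

theorem CompRel.reify {C : CTy (n + 1)} {T : Mon} {N : Comp m} {A : VTy n}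
    {d : Env Γ θ → (Eff.layer E C T).T θ (A.car θ)}
    (hN : CompRel Γ θ (.layer E C T) N (.F A) d) :
    CompRel Γ θ E (.reify T N) (C.inst A)
      (fun γ => cast (car_inst C A θ (E.T θ)).symm (d γ)) :=
  fun ρ hρ s γ h => by
    simp only [Comp.subst]
    exact (Sem.rel_iff_symm (C.sem_inst A ρ (E.sem θ ρ)) (car_inst C A θ (E.T θ)).symm _ _).2
      (hN ρ hρ s γ h).1

theorem CompRel.reflect {C : CTy (n + 1)} {T : Mon} {μ : RetBind ((Eff.layer E C T).T θ)}
    (hT : ∀ ρ : RelEnv θ, (∀ i, Zigzag (ρ i)) → (Eff.layer E C T).Model θ ρ μ) {N : Comp m}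
    {A : VTy n} {d : Env Γ θ → (C.inst A).car θ (E.T θ)} (hN : CompRel Γ θ E N (C.inst A) d) :
    CompRel Γ θ (.layer E C T) (.reflect N) (.F A)
      (fun γ => cast (car_inst C A θ (E.T θ)) (d γ)) :=
  fun ρ hρ s γ h => by
    simp only [Comp.subst]
    exact MonModel.reflect (hT ρ hρ) (A.rel_zigzag hρ)
      ((Sem.rel_iff (C.sem_inst A ρ (E.sem θ ρ)) (car_inst C A θ (E.T θ)) _ _).1
        (hN ρ hρ s γ h))

end rules

/-! ### The fundamental lemma -/

/-- Parametricity: the type variable of the return body is interpreted by `S`, those of the bind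
body by `S` and `S'`. Weakening and renaming equalities of the bundled semantics absorb the casts in
the denotations. -/
theorem monModel_of_compRel {n : ℕ} {E : Eff n} {C : CTy (n + 1)} {Nu : Comp 1} {Nb : Comp 2}
    {kE : KEff E} {kC : KComp E.wk C} {du : DComp ctxRet E.wk Nu C}
    {db : DComp (ctxBind E C) E.wk.wk Nb C.at₂} {θ : Fin n → Type u}
    (hμ : ((KEff.layer kE kC du db).mon θ).IsMonad)
    (hu : ∀ X : Type u, CompRel ctxRet (push X θ) E.wk Nu C (du.den (push X θ)))
    (hb : ∀ X Y : Type u, CompRel (ctxBind E C) (push Y (push X θ)) E.wk.wk Nb C.at₂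
      (db.den (push Y (push X θ)))) {ρ : RelEnv θ} (hρ : ∀ i, Zigzag (ρ i)) :
    (Eff.layer E C (.mk Nu Nb)).Model θ ρ ((KEff.layer kE kC du db).mon θ) where
  expand _ _ _ _ _ h ht := C.rel_expand (E.rel_expansive θ ρ) h ht
  zigzag _ _ hS := C.rel_zigzag (pushRel_zigzag hρ hS) (E.rel_zigzag hρ)
  isMonad := ⟨fun x f => hμ.ret_bind x f, fun t => hμ.bind_ret t, fun t f g => hμ.bind_bind t f g⟩
  reify_ret {X S} hS V x hx := by
    refine C.rel_expand (E.rel_expansive θ ρ) (DStep.reify Nu Nb V) ?_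
    have h := hu X (pushRel S ρ) (pushRel_zigzag hρ hS) (push V Fin.elim0)
      (Env.push (A := .tvar 0) (x : (push X θ) 0) (fun i => i.elim0))
      (rel_push (fun i => i.elim0) hx)
    exact (Sem.rel_iff (congrArg (C.sem (push X θ) (pushRel S ρ)) (E.sem_wk ρ S))
      (car_ret E C θ X) _ _).1 h
  reify_reflect H N t ht := C.rel_expand (E.rel_expansive θ ρ) (DStep.reflect Nu Nb H N) ht
  bind {X Y S S'} hS hS' H N t k ht hk := by
    have hE : E.wk.wk.sem (push Y (push X θ)) (pushRel S' (pushRel S ρ)) = E.sem θ ρ := by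
      rw [Eff.sem_wk, Eff.sem_wk]
    have h₁ := (C.sem_at₁ ρ S S' _).trans (congrArg (C.sem (push X θ) (pushRel S ρ)) hE)
    have h₂ := (C.sem_at₂ ρ S S' _).trans (congrArg (C.sem (push Y θ) (pushRel S' ρ)) hE)
    refine (Sem.rel_iff h₂ (car_at₂ E C θ X Y) _ _).1
      (hb X Y _ (pushRel_zigzag (pushRel_zigzag hρ hS) hS') _ _
        (rel_push (rel_push (fun i => i.elim0) ?_) ?_))
    -- The argument `y` is the thunk of `N`, related to `t`.
    · exact CompRel.expand (DStep.force N)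
        ((Sem.rel_iff_symm h₁ (car_at₁ E C θ X Y).symm _ _).2 ht)
    · intro V x hx
      -- The argument `f` is the continuation thunk; forced and applied to `V` it reaches `[H[return
      -- V]]^T`.
      refine rel_of_dsteps (fun _ _ h ht => CompRel.expand h ht) (contThunk_steps _ H V) ?_
      exact (Sem.rel_iff_symm h₂ (car_at₂ E C θ X Y).symm _ _).2 (hk V x hx)

theorem KVal.injective {n k : ℕ} {l : Fin k → ℕ} {A : Fin k → VTy n}
    (kA : KVal (VTy.variant k l A)) : Function.Injective l := by
  cases kA with
  | variant hl _ => exact hl.injective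

mutual
theorem KEff.model : {n : ℕ} → {E : Eff n} → (kE : KEff E) → {θ : Fin n → Type u} →
    kE.Defined θ → (ρ : RelEnv θ) → (∀ i, Zigzag (ρ i)) → E.Model θ ρ (kE.mon θ)
  | n, _, .pure, θ, _, ρ, _ => pure_adequate n θ ρ
  | _, _, .layer _ _ du db, _, h, _, hρ =>
      monModel_of_compRel h.2.2.2.2 (fun X => du.compRel (h.2.2.1 X))
        (fun X Y => db.compRel (h.2.2.2.1 X Y)) hρ
theorem DVal.valRel : {n m : ℕ} → {Γ : Fin m → VTy n} → {V : Val m} → {A : VTy n} →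
    (d : DVal Γ V A) → {θ : Fin n → Type u} → d.Defined θ → ValRel Γ θ V A (d.den θ)
  | _, _, _, _, _, .var (Γ := Γ) _ i, _, _ => ValRel.var i
  | _, _, _, _, _, .unit _, _, _ => ValRel.unit
  | _, _, _, _, _, .pair dV dW, _, h => ValRel.pair (dV.valRel h.1) (dW.valRel h.2)
  | _, _, _, _, _, .inj kA i dV, _, h => ValRel.inj kA.injective i (dV.valRel h.2)
  | _, _, _, _, _, .thunk dM, _, h => ValRel.thunk (dM.compRel h)
theorem DComp.compRel : {n m : ℕ} → {Γ : Fin m → VTy n} → {E : Eff n} → {M : Comp m} →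
    {C : CTy n} → (d : DComp Γ E M C) → {θ : Fin n → Type u} → d.Defined θ →
    CompRel Γ θ E M C (d.den θ)
  | _, _, _, _, _, _, .split dV dM, _, h => CompRel.split (dV.valRel h.1) (dM.compRel h.2)
  | _, _, _, _, _, _, .vcase _ _ dV dM, _, h =>
      CompRel.vcase (dV.valRel h.2.2.1) (fun i => (dM i).compRel (h.2.2.2 i))
  | _, _, _, _, _, _, .force dV, _, h => CompRel.force (dV.valRel h)
  | _, _, _, _, _, _, .ret kE dV, _, h => CompRel.ret (kE.model h.1) (dV.valRel h.2)
  | _, _, _, _, _, _, .seq kE dM dN, _, h =>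
      CompRel.seq (kE.model h.1) (dM.compRel h.2.1) (dN.compRel h.2.2)
  | _, _, _, _, _, _, .lam dM, _, h => CompRel.lam (dM.compRel h)
  | _, _, _, _, _, _, .app dM dV, _, h => CompRel.app (dM.compRel h.1) (dV.valRel h.2)
  | _, _, _, _, _, _, .cpair dM dN, _, h => CompRel.cpair (dM.compRel h.1) (dN.compRel h.2)
  | _, _, _, _, _, _, .fst dM, _, h => CompRel.fst (dM.compRel h)
  | _, _, _, _, _, _, .snd dM, _, h => CompRel.snd (dM.compRel h)
  | _, _, _, _, _, _, .reify _ dN, _, h => CompRel.reify (dN.compRel h.2)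
  | _, _, _, _, _, _, .reflect kT _ dN, _, h =>
      CompRel.reflect (kT.model h.1) (dN.compRel h.2.2)
end

/-! ### Plugged contexts -/

/-- Extending the environments of a hole needs no renaming of derivations: the realized function
itself is transported. -/
theorem ValRel.rename {n₀ m₀ n m : ℕ} {Γ₀ : Fin m₀ → VTy n₀} {Γ : Fin m → VTy n}
    {r : Fin n₀ → Fin n} {p : Fin m₀ → Fin m} (hΓ : ∀ i, Γ (p i) = (Γ₀ i).rename r)
    {θ : Fin n → Type u} {V : Val m₀} {A : VTy n₀}
    {d : Env Γ₀ (fun i => θ (r i)) → A.car (fun i => θ (r i))}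
    (h : ValRel Γ₀ (fun i => θ (r i)) V A d) :
    ValRel Γ θ (V.rename p) (A.rename r) (fun γ => cast (A.car_rename r θ).symm
      (d (fun i => cast (by rw [hΓ, VTy.car_rename]) (γ (p i))))) := by
  intro ρ hρ s γ hγ
  rw [Val.subst_rename]
  refine (Sem.rel_iff_symm (A.sem_rename r θ ρ) (A.car_rename r θ).symm _ _).2
    (h _ (fun i => hρ (r i)) _ _ (fun i => ?_))
  have e : (Γ (p i)).sem θ ρ = (Γ₀ i).sem (fun i => θ (r i)) (fun i => ρ (r i)) := by
    rw [hΓ, VTy.sem_rename]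
  exact (Sem.rel_iff e (congrArg Sigma.fst e) _ _).1 (hγ (p i))

theorem CompRel.rename {n₀ m₀ n m : ℕ} {Γ₀ : Fin m₀ → VTy n₀} {Γ : Fin m → VTy n}
    {r : Fin n₀ → Fin n} {p : Fin m₀ → Fin m} (hΓ : ∀ i, Γ (p i) = (Γ₀ i).rename r)
    {θ : Fin n → Type u} {E : Eff n₀} {M : Comp m₀} {C : CTy n₀}
    {d : Env Γ₀ (fun i => θ (r i)) → C.car (fun i => θ (r i)) (E.T (fun i => θ (r i)))}
    (h : CompRel Γ₀ (fun i => θ (r i)) E M C d) :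
    CompRel Γ θ (E.rename r) (M.rename p) (C.rename r)
      (fun γ => cast (by rw [CTy.car_rename, Eff.T_rename])
        (d (fun i => cast (by rw [hΓ, VTy.car_rename]) (γ (p i))))) := by
  intro ρ hρ s γ hγ
  rw [Comp.subst_rename]
  have e : (C.rename r).sem θ ρ ((E.rename r).sem θ ρ) =
      C.sem (fun i => θ (r i)) (fun i => ρ (r i)) (E.sem _ (fun i => ρ (r i))) := by
    rw [CTy.sem_rename, Eff.sem_rename]
  refine (Sem.rel_iff_symm e (congrArg Sigma.fst e).symm _ _).2
    (h _ (fun i => hρ (r i)) _ _ (fun i => ?_))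
  have e : (Γ (p i)).sem θ ρ = (Γ₀ i).sem (fun i => θ (r i)) (fun i => ρ (r i)) := by
    rw [hΓ, VTy.sem_rename]
  exact (Sem.rel_iff e (congrArg Sigma.fst e) _ _).1 (hγ (p i))

/-- Two value terms realize a common function at every type assignment. -/
def ValPair {n m : ℕ} (Γ : Fin m → VTy n) (V V' : Val m) (A : VTy n) : Prop :=
  ∀ θ : Fin n → Type u, ∃ d, ValRel Γ θ V A d ∧ ValRel Γ θ V' A d

/-- Two computation terms realize a common function at every type assignment. -/
def CompPair {n m : ℕ} (Γ : Fin m → VTy n) (E : Eff n) (M M' : Comp m) (C : CTy n) : Prop :=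
  ∀ θ : Fin n → Type u, ∃ d, CompRel Γ θ E M C d ∧ CompRel Γ θ E M' C d

/-- The term and its type are abstracted by equations, since the label `l i` in the index would
obstruct inversion of the derivation. -/
theorem DVal.injective_of_inj {n m k : ℕ} {Γ : Fin m → VTy n} {W : Val m} {B : VTy n}
    (d : DVal Γ W B) {l : Fin k → ℕ} {A : Fin k → VTy n} (hB : B = VTy.variant k l A) {j : ℕ}
    {V : Val m} (hW : W = Val.inj j V) : Function.Injective l := by
  cases d with
  | inj kA i dV =>
      cases hB
      exact kA.injective
  | _ => cases hW

theorem ProperComp.eff_of_ret {n m : ℕ} {Γ : Fin m → VTy n} {E : Eff n} {V : Val m} {C : CTy n}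
    (p : ProperComp.{u} Γ E (.ret V) C) :
    ∃ kE : KEff E, ∀ θ : Fin n → Type u, kE.Defined θ := by
  obtain ⟨d, h⟩ := p
  cases d with
  | ret kE dV => exact ⟨kE, fun θ => (h θ).1⟩

theorem ProperComp.eff_of_seq {n m : ℕ} {Γ : Fin m → VTy n} {E : Eff n} {M : Comp m}
    {N : Comp (m + 1)} {C : CTy n} (p : ProperComp.{u} Γ E (.seq M N) C) :
    ∃ kE : KEff E, ∀ θ : Fin n → Type u, kE.Defined θ := by
  obtain ⟨d, h⟩ := p
  cases d with
  | seq kE dM dN => exact ⟨kE, fun θ => (h θ).1⟩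

theorem ProperComp.eff_of_reflect {n m : ℕ} {Γ : Fin m → VTy n} {E : Eff n} {N : Comp m}
    {C : CTy n} (p : ProperComp.{u} Γ E (.reflect N) C) :
    ∃ kE : KEff E, ∀ θ : Fin n → Type u, kE.Defined θ := by
  obtain ⟨d, h⟩ := p
  cases d with
  | reflect kT kA dN => exact ⟨kT, fun θ => (h θ).1⟩

mutual
theorem PlugVal.valPair {BV : ValTuples} {BC : CompTuples}
    (hV : ∀ ⦃n m : ℕ⦄ ⦃Γ : Fin m → VTy n⦄ ⦃V V' A⦄, BV Γ V V' A → ValPair.{u} Γ V V' A)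
    (hC : ∀ ⦃n m : ℕ⦄ ⦃Γ : Fin m → VTy n⦄ ⦃E M M' C⦄, BC Γ E M M' C → CompPair.{u} Γ E M M' C) :
    {n m : ℕ} → {Γ : Fin m → VTy n} → {V V' : Val m} → {A : VTy n} →
    PlugVal.{u} BV BC Γ V V' A → ValPair.{u} Γ V V' A
  | _, _, _, _, _, _, .base h _ _ => hV h
  | _, _, _, _, _, _, .var (Γ := Γ) i _ => fun _ => ⟨_, ValRel.var i, ValRel.var i⟩
  | _, _, _, _, _, _, .unit _ => fun _ => ⟨_, ValRel.unit, ValRel.unit⟩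
  | _, _, _, _, _, _, .pair h₁ h₂ _ _ => fun θ => by
      obtain ⟨_, a, a'⟩ := h₁.valPair hV hC θ
      obtain ⟨_, b, b'⟩ := h₂.valPair hV hC θ
      exact ⟨_, a.pair b, a'.pair b'⟩
  | _, _, _, _, _, _, .inj i h p _ => fun θ => by
      obtain ⟨_, a, a'⟩ := h.valPair hV hC θ
      obtain ⟨d, -⟩ := p
      have hl := d.injective_of_inj rfl rfl
      exact ⟨_, ValRel.inj hl i a, ValRel.inj hl i a'⟩
  | _, _, _, _, _, _, .thunk h _ _ => fun θ => by
      obtain ⟨_, a, a'⟩ := h.compPair hV hC θ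
      exact ⟨_, ValRel.thunk a, ValRel.thunk a'⟩
-- Each rule builds one function from the functions of the premises and applies to both sides.
theorem PlugComp.compPair {BV : ValTuples} {BC : CompTuples}
    (hV : ∀ ⦃n m : ℕ⦄ ⦃Γ : Fin m → VTy n⦄ ⦃V V' A⦄, BV Γ V V' A → ValPair.{u} Γ V V' A)
    (hC : ∀ ⦃n m : ℕ⦄ ⦃Γ : Fin m → VTy n⦄ ⦃E M M' C⦄, BC Γ E M M' C → CompPair.{u} Γ E M M' C) :
    {n m : ℕ} → {Γ : Fin m → VTy n} → {E : Eff n} → {M M' : Comp m} → {C : CTy n} →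
    PlugComp.{u} BV BC Γ E M M' C → CompPair.{u} Γ E M M' C
  | _, _, _, _, _, _, _, .base h _ _ => hC h
  | _, _, _, _, _, _, _, .split h₁ h₂ _ _ => fun θ => by
      obtain ⟨_, a, a'⟩ := h₁.valPair hV hC θ
      obtain ⟨_, b, b'⟩ := h₂.compPair hV hC θ
      exact ⟨_, CompRel.split a b, CompRel.split a' b'⟩
  | _, _, _, _, _, _, _, .vcase h₁ h₂ _ _ => fun θ => by
      obtain ⟨_, a, a'⟩ := h₁.valPair hV hC θ
      choose _ b b' using fun i => (h₂ i).compPair hV hC θ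
      exact ⟨_, CompRel.vcase a b, CompRel.vcase a' b'⟩
  | _, _, _, _, _, _, _, .force h _ _ => fun θ => by
      obtain ⟨_, a, a'⟩ := h.valPair hV hC θ
      exact ⟨_, CompRel.force a, CompRel.force a'⟩
  | _, _, _, _, _, _, _, .ret h p _ => fun θ => by
      obtain ⟨_, a, a'⟩ := h.valPair hV hC θ
      -- The monad structure is taken from the left term's derivation and serves both sides, since
      -- any defined derivation of the raw effect is a model.
      obtain ⟨kE, hE⟩ := p.eff_of_ret
      exact ⟨_, CompRel.ret (kE.model (hE θ)) a, CompRel.ret (kE.model (hE θ)) a'⟩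
  | _, _, _, _, _, _, _, .seq h₁ h₂ p _ => fun θ => by
      obtain ⟨_, a, a'⟩ := h₁.compPair hV hC θ
      obtain ⟨_, b, b'⟩ := h₂.compPair hV hC θ
      obtain ⟨kE, hE⟩ := p.eff_of_seq
      exact ⟨_, CompRel.seq (kE.model (hE θ)) a b, CompRel.seq (kE.model (hE θ)) a' b'⟩
  | _, _, _, _, _, _, _, .lam h _ _ => fun θ => by
      obtain ⟨_, a, a'⟩ := h.compPair hV hC θ
      exact ⟨_, CompRel.lam a, CompRel.lam a'⟩
  | _, _, _, _, _, _, _, .app h₁ h₂ _ _ => fun θ => by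
      obtain ⟨_, a, a'⟩ := h₁.compPair hV hC θ
      obtain ⟨_, b, b'⟩ := h₂.valPair hV hC θ
      exact ⟨_, CompRel.app a b, CompRel.app a' b'⟩
  | _, _, _, _, _, _, _, .cpair h₁ h₂ _ _ => fun θ => by
      obtain ⟨_, a, a'⟩ := h₁.compPair hV hC θ
      obtain ⟨_, b, b'⟩ := h₂.compPair hV hC θ
      exact ⟨_, CompRel.cpair a b, CompRel.cpair a' b'⟩
  | _, _, _, _, _, _, _, .fst h _ _ => fun θ => by
      obtain ⟨_, a, a'⟩ := h.compPair hV hC θ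
      exact ⟨_, CompRel.fst a, CompRel.fst a'⟩
  | _, _, _, _, _, _, _, .snd h _ _ => fun θ => by
      obtain ⟨_, a, a'⟩ := h.compPair hV hC θ
      exact ⟨_, CompRel.snd a, CompRel.snd a'⟩
  | _, _, _, _, _, _, _, .reify h _ _ => fun θ => by
      obtain ⟨_, a, a'⟩ := h.compPair hV hC θ
      exact ⟨_, CompRel.reify a, CompRel.reify a'⟩
  | _, _, _, _, _, _, _, .reflect h p _ => fun θ => by
      obtain ⟨_, a, a'⟩ := h.compPair hV hC θ
      obtain ⟨kT, hT⟩ := p.eff_of_reflect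
      exact ⟨_, CompRel.reflect (kT.model (hT θ)) a, CompRel.reflect (kT.model (hT θ)) a'⟩
end

/-! ### Adequacy -/

theorem Ground.rel_unique {G : VTy 0} (hG : Ground G) {θ : Fin 0 → Type u} {ρ : RelEnv θ}
    {V W : Val 0} {a : G.car θ} (hV : G.rel θ ρ V a) (hW : G.rel θ ρ W a) : V = W := by
  induction hG generalizing V W with
  | unit => exact Eq.trans hV (Eq.symm hW)
  | prod _ _ ihG ihH =>
      obtain ⟨V₁, V₂, rfl, h₁, h₂⟩ := hV
      obtain ⟨W₁, W₂, rfl, k₁, k₂⟩ := hW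
      rw [ihG h₁ k₁, ihH h₂ k₂]
  | variant _ _ ih =>
      obtain ⟨-, V, rfl, h⟩ := hV
      obtain ⟨-, W, rfl, k⟩ := hW
      rw [ih _ h k]

/-- For the empty effect, being related includes termination at a value. Both values code the same
ground element, so they coincide, and determinism excludes other results. -/
theorem CompPair.steps_ret_iff {G : VTy 0} (hG : Ground G) {M N : Comp 0}
    (h : CompPair.{u} (Fin.elim0 : Fin 0 → VTy 0) Eff.pure M N (.F G)) (V : Val 0) :
    Steps M (.ret V) ↔ Steps N (.ret V) := by
  obtain ⟨d, hM, hN⟩ := h (fun i => i.elim0)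
  obtain ⟨V₁, h₁, r₁⟩ := hM (fun i => i.elim0) (fun i => i.elim0) Val.var (fun i => i.elim0)
    (fun i => i.elim0)
  obtain ⟨V₂, h₂, r₂⟩ := hN (fun i => i.elim0) (fun i => i.elim0) Val.var (fun i => i.elim0)
    (fun i => i.elim0)
  rw [Comp.subst_var] at h₁ h₂
  rw [h₁.steps_ret_iff, h₂.steps_ret_iff, hG.rel_unique r₁ r₂]

theorem sameResults_of_pairs {BV : ValTuples} {BC : CompTuples}
    (hV : ∀ ⦃n m : ℕ⦄ ⦃Γ : Fin m → VTy n⦄ ⦃V V' A⦄, BV Γ V V' A → ValPair.{u} Γ V V' A)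
    (hC : ∀ ⦃n m : ℕ⦄ ⦃Γ : Fin m → VTy n⦄ ⦃E M M' C⦄, BC Γ E M M' C → CompPair.{u} Γ E M M' C) :
    SameResults.{u} BV BC :=
  fun _ _ _ hG h V _ => (h.compPair hV hC).steps_ret_iff hG V

theorem ctxEquivVal_of_den_eq {n m : ℕ} {Γ : Fin m → VTy n} {V W : Val m} {A : VTy n}
    (dV : DVal Γ V A) (dW : DVal Γ W A) (hV : DVal.Proper.{u} dV) (hW : DVal.Proper.{u} dW)
    (h : ∀ θ : Fin n → Type u, dV.den θ = dW.den θ) : CtxEquivVal.{u} Γ V W A := by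
  refine sameResults_of_pairs ?_ (fun _ _ _ _ _ _ _ h => h.elim)
  rintro n' m' Γ' _ _ _ ⟨r, p, -, -, hΓ, rfl, rfl, rfl⟩ θ
  -- The equality of denotations makes both terms realize the function denoted by `dV`.
  exact ⟨_, (dV.valRel (hV _)).rename hΓ, (h _ ▸ dW.valRel (hW _)).rename hΓ⟩

theorem ctxEquivComp_of_den_eq {n m : ℕ} {Γ : Fin m → VTy n} {E : Eff n} {P Q : Comp m}
    {C : CTy n} (dP : DComp Γ E P C) (dQ : DComp Γ E Q C) (hP : DComp.Proper.{u} dP)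
    (hQ : DComp.Proper.{u} dQ) (h : ∀ θ : Fin n → Type u, dP.den θ = dQ.den θ) :
    CtxEquivComp.{u} Γ E P Q C := by
  refine sameResults_of_pairs (fun _ _ _ _ _ _ h => h.elim) ?_
  rintro n' m' Γ' _ _ _ _ ⟨r, p, -, -, hΓ, rfl, rfl, rfl, rfl⟩ θ
  exact ⟨_, (dP.compRel (hP _)).rename hΓ, (h _ ▸ dQ.compRel (hQ _)).rename hΓ⟩

end LMon

theorem mainTheorem4 :
    (∀ (n m : ℕ) (Γ : Fin m → LMon.VTy n) (V W : LMon.Val m) (A : LMon.VTy n)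
      (dV : LMon.DVal Γ V A) (dW : LMon.DVal Γ W A),
      LMon.DVal.Proper.{u} dV → LMon.DVal.Proper.{u} dW →
      (∀ θ : Fin n → Type u, dV.den θ = dW.den θ) →
      LMon.CtxEquivVal.{u} Γ V W A) ∧
    (∀ (n m : ℕ) (Γ : Fin m → LMon.VTy n) (E : LMon.Eff n) (P Q : LMon.Comp m) (C : LMon.CTy n)
      (dP : LMon.DComp Γ E P C) (dQ : LMon.DComp Γ E Q C),
      LMon.DComp.Proper.{u} dP → LMon.DComp.Proper.{u} dQ →
      (∀ θ : Fin n → Type u, dP.den θ = dQ.den θ) →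
      LMon.CtxEquivComp.{u} Γ E P Q C) := by
  exact ⟨fun _ _ _ _ _ _ dV dW hV hW h => LMon.ctxEquivVal_of_den_eq dV dW hV hW h,
    fun _ _ _ _ _ _ _ dP dQ hP hQ h => LMon.ctxEquivComp_of_den_eq dP dQ hP hQ h⟩
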